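/- Let $a_{11},a_{02},a_{30},a_{21},a_{12},a_{03}\in\mathbb{R}$. A point $p\in\mathbb{R}^2$ is a center of a planar differential system if it is a singular point of the system and has a neighborhood $U$ such that all the orbits of $U\setminus\{p\}$ are (nonconstant) periodic orbits. A center of an analytic system is called nilpotent if, after an affine change of variables sending $p$ to the origin and a rescaling of the time by a nonzero constant, the system can be written near the origin in the form $\dot x=y+F_1(x,y)$, $\dot y=F_2(x,y)$, where $F_1$ and $F_2$ are real analytic functions without constant and linear terms, defined in a neighborhood of the origin. Then the real system $$\dot x=-y+a_{11}xy+a_{02}y^2+a_{30}x^3+a_{21}x^2y+a_{12}xy^2+a_{03}y^3,\qquad \dot y=x^3$$ has a nilpotent center at the origin if and only if $$a_{30}=0,\qquad a_{02}a_{11}+a_{12}=0,\qquad a_{02}a_{11}a_{21}=0\qquad\text{and}\qquad a_{02}a_{11}a_{03}=0.$$ -/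

import Mathlib

open Filter Topology

namespace PlanarSystem

/-- The orbit of the autonomous system `ż = v z` through `q` is a (nonconstant) periodic orbit
contained in the set `S`. -/
def HasPeriodicOrbitIn (v : ℝ × ℝ → ℝ × ℝ) (q : ℝ × ℝ) (S : Set (ℝ × ℝ)) : Prop :=
  ∃ γ : ℝ → ℝ × ℝ, IsIntegralCurve γ (fun _ => v) ∧ γ 0 = q ∧
    (∃ T : ℝ, 0 < T ∧ Function.Periodic γ T) ∧ (∃ t : ℝ, γ t ≠ q) ∧ ∀ t : ℝ, γ t ∈ S

/-- `p` is a center of `ż = v z`: it is a singular point, and it has a neighborhood `U` such that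
all the orbits of `U \ {p}` are periodic. -/
def IsCenter (v : ℝ × ℝ → ℝ × ℝ) (p : ℝ × ℝ) : Prop :=
  v p = 0 ∧ ∃ U ∈ 𝓝 p, ∀ q ∈ U \ {p}, HasPeriodicOrbitIn v q (U \ {p})

/-- `F` is real analytic near the origin, without constant and linear terms. -/
def IsAnalyticHigherOrder (F : ℝ × ℝ → ℝ) : Prop :=
  AnalyticAt ℝ F 0 ∧ F 0 = 0 ∧ fderiv ℝ F 0 = 0

/-- After an affine change of variables `w = p + L z` sending the origin to `p` and a rescaling of
the time by a nonzero constant `c`, the system `ẇ = v w` can be written near the origin as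
`ẋ = y + F₁(x, y)`, `ẏ = F₂(x, y)` with `F₁`, `F₂` analytic without constant and linear terms. -/
def HasNilpotentForm (v : ℝ × ℝ → ℝ × ℝ) (p : ℝ × ℝ) : Prop :=
  ∃ (L : (ℝ × ℝ) ≃L[ℝ] (ℝ × ℝ)) (c : ℝ) (F₁ F₂ : ℝ × ℝ → ℝ),
    c ≠ 0 ∧ IsAnalyticHigherOrder F₁ ∧ IsAnalyticHigherOrder F₂ ∧
    ∀ᶠ z in 𝓝 (0 : ℝ × ℝ), c • L.symm (v (p + L z)) = (z.2 + F₁ z, F₂ z)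

/-- A nilpotent center: a center of an analytic system which can be brought to nilpotent form. -/
def IsNilpotentCenter (v : ℝ × ℝ → ℝ × ℝ) (p : ℝ × ℝ) : Prop :=
  IsCenter v p ∧ HasNilpotentForm v p

/-- The vector field of the system
`ẋ = -y + a₁₁xy + a₀₂y² + a₃₀x³ + a₂₁x²y + a₁₂xy² + a₀₃y³`, `ẏ = x³`. -/
def cubicField (a₁₁ a₀₂ a₃₀ a₂₁ a₁₂ a₀₃ : ℝ) (z : ℝ × ℝ) : ℝ × ℝ :=
  (-z.2 + a₁₁ * z.1 * z.2 + a₀₂ * z.2 ^ 2 + a₃₀ * z.1 ^ 3 + a₂₁ * z.1 ^ 2 * z.2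
      + a₁₂ * z.1 * z.2 ^ 2 + a₀₃ * z.2 ^ 3,
    z.1 ^ 3)

end PlanarSystem

namespace PlanarSystem

/-- A bounded Lipschitz vector field has a global integral curve through every point. -/
theorem exists_isIntegralCurve_of_lipschitzWith {E : Type*} [NormedAddCommGroup E]
    [NormedSpace ℝ E] [CompleteSpace E] {v : E → E} {K L : NNReal} (hv : LipschitzWith K v)
    (hL : ∀ x, ‖v x‖ ≤ L) (x₀ : E) :
    ∃ γ : ℝ → E, IsIntegralCurve γ (fun _ => v) ∧ γ 0 = x₀ := by
  have local_sol : ∀ n : ℕ, ∃ α : ℝ → E, α 0 = x₀ ∧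
      ∀ t ∈ Set.Ioo (-(n + 1) : ℝ) (n + 1), HasDerivAt α (v (α t)) t := by
    intro n
    have hn : (0 : ℝ) < n + 1 := by positivity
    let t₀ : Set.Icc (-(n + 1) : ℝ) (n + 1) := ⟨0, by constructor <;> linarith⟩
    have hPL : IsPicardLindelof (fun _ => v) t₀ x₀ (L * (n + 1)) 0 L K :=
      IsPicardLindelof.of_time_independent (fun x _ => hL x) hv.lipschitzOnWith (by simp [t₀])
    obtain ⟨α, h0, hα⟩ := hPL.exists_eq_forall_mem_Icc_hasDerivWithinAt₀
    exact ⟨α, h0, fun t ht => (hα t (Set.Ioo_subset_Icc_self ht)).hasDerivAt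
      (Icc_mem_nhds ht.1 ht.2)⟩
  choose α h0 hα using local_sol
  have agree : ∀ n m : ℕ, n ≤ m → Set.EqOn (α n) (α m) (Set.Ioo (-(n + 1) : ℝ) (n + 1)) := by
    intro n m hnm
    have hnm' : (n : ℝ) ≤ m := by exact_mod_cast hnm
    have hn : (0 : ℝ) < n + 1 := by positivity
    refine ODE_solution_unique_of_mem_Ioo (v := fun _ => v) (s := fun _ => Set.univ) (t₀ := 0)
      (fun t _ => hv.lipschitzOnWith) (by constructor <;> linarith)
      (fun t ht => ⟨hα n t ht, trivial⟩)
      (fun t ht => ⟨hα m t ⟨by linarith [ht.1], by linarith [ht.2]⟩, trivial⟩) ?_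
    rw [h0, h0]
  refine ⟨fun t => α ⌈|t|⌉₊ t, fun t => ?_, by simp [h0]⟩
  set N := ⌈|t|⌉₊ + 1 with hN
  have ht : |t| < N := by
    have := Nat.le_ceil |t|
    rw [hN]; push_cast; linarith
  have key : ∀ s : ℝ, |s| < N → α ⌈|s|⌉₊ s = α N s := by
    intro s hs
    refine agree _ _ (Nat.ceil_le.2 hs.le) ?_
    have := Nat.le_ceil |s|
    rw [Set.mem_Ioo, ← abs_lt]
    linarith
  have hev : (fun s => α ⌈|s|⌉₊ s) =ᶠ[𝓝 t] α N := by
    filter_upwards [(isOpen_lt continuous_abs continuous_const).mem_nhds ht] with s hs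
    exact key s hs
  have hd := hα N t (by rw [Set.mem_Ioo, ← abs_lt]; linarith)
  rw [← key t ht] at hd
  exact hd.congr_of_eventuallyEq hev

theorem isIntegralCurve_eq_of_lipschitzWith {E : Type*} [NormedAddCommGroup E]
    [NormedSpace ℝ E] {v : E → E} {K : NNReal} (hv : LipschitzWith K v) {γ δ : ℝ → E}
    (hγ : IsIntegralCurve γ (fun _ => v)) (hδ : IsIntegralCurve δ (fun _ => v)) {t₀ : ℝ}
    (h : γ t₀ = δ t₀) : γ = δ :=
  ODE_solution_unique_univ (v := fun _ => v) (s := fun _ => Set.univ)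
    (fun _ => hv.lipschitzOnWith) (fun t => ⟨hγ t, trivial⟩) (fun t => ⟨hδ t, trivial⟩) h

/-- An integral curve which returns to one of its points is periodic. -/
theorem periodic_of_return {E : Type*} [NormedAddCommGroup E] [NormedSpace ℝ E] {v : E → E}
    {K : NNReal} (hv : LipschitzWith K v) {γ : ℝ → E} (hγ : IsIntegralCurve γ (fun _ => v))
    {s t : ℝ} (h : γ s = γ t) : Function.Periodic γ (t - s) := by
  have h1 : IsIntegralCurve (γ ∘ (· + (t - s))) (fun _ => v) := hγ.comp_add (t - s)
  have h2 := isIntegralCurve_eq_of_lipschitzWith hv h1 hγ (t₀ := s) (by simp [h])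
  exact fun x => congrFun h2 x

/-- If `w` grows as long as `u` is positive, and `u` decreases at a rate bounded below in terms
of `w`, then `u` reaches zero. -/
theorem exists_first_zero {u w a b φ : ℝ → ℝ} (hu : ∀ t, HasDerivAt u (-a t) t)
    (hw : ∀ t, HasDerivAt w (b t) t) (hb : ∀ t, 0 < u t → 0 < b t)
    (ha : ∀ t c, 0 < c → c ≤ w t → φ c ≤ a t) (hφ : ∀ c, 0 < c → 0 < φ c) {t₀ : ℝ}
    (hu₀ : 0 < u t₀) (hw₀ : 0 ≤ w t₀) :
    ∃ t₁, t₀ < t₁ ∧ u t₁ = 0 ∧ 0 < w t₁ ∧ ∀ t ∈ Set.Icc t₀ t₁, 0 ≤ u t ∧ 0 ≤ w t := by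
  have hcu : Continuous u := continuous_iff_continuousAt.2 fun t => (hu t).continuousAt
  have hcw : Continuous w := continuous_iff_continuousAt.2 fun t => (hw t).continuousAt
  have hmono : ∀ s, (∀ t ∈ Set.Ioo t₀ s, 0 < u t) → StrictMonoOn w (Set.Icc t₀ s) := by
    intro s hs
    refine strictMonoOn_of_deriv_pos (convex_Icc _ _) hcw.continuousOn fun t ht => ?_
    rw [interior_Icc] at ht
    rw [(hw t).deriv]
    exact hb t (hs t ht)
  have hex : ∃ t, t₀ ≤ t ∧ u t ≤ 0 := by
    by_contra! hpos
    have hc : 0 < w (t₀ + 1) := hw₀.trans_lt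
      (hmono (t₀ + 1) (fun t ht => hpos t ht.1.le) ⟨le_rfl, by linarith⟩ ⟨by linarith, le_rfl⟩
        (by linarith))
    set c := w (t₀ + 1)
    have hp := hφ c hc
    have hle : ∀ t, t₀ + 1 ≤ t → c ≤ w t := fun t ht =>
      (hmono t (fun s hs => hpos s hs.1.le)).monotoneOn ⟨by linarith, ht⟩ ⟨by linarith, le_rfl⟩ ht
    have hbd := (convex_Ici (t₀ + 1)).image_sub_le_mul_sub_of_deriv_le hcu.continuousOn
      (fun t _ => (hu t).differentiableAt.differentiableWithinAt) (C := -φ c) (fun t ht => by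
        rw [interior_Ici] at ht
        rw [(hu t).deriv]
        exact neg_le_neg (ha t c hc (hle t (le_of_lt ht))))
    have hu1 := hpos (t₀ + 1) (by linarith)
    have hq : 0 < u (t₀ + 1) / φ c := div_pos hu1 hp
    have h1 := hbd (t₀ + 1) Set.self_mem_Ici (t₀ + 1 + u (t₀ + 1) / φ c)
      (by rw [Set.mem_Ici]; linarith) (by linarith)
    have h2 := hpos (t₀ + 1 + u (t₀ + 1) / φ c) (by linarith)
    have h3 : -φ c * (t₀ + 1 + u (t₀ + 1) / φ c - (t₀ + 1)) = -u (t₀ + 1) := by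
      field_simp; ring
    linarith
  have hne : {t | t₀ ≤ t ∧ u t ≤ 0}.Nonempty := hex
  have hbdd : BddBelow {t | t₀ ≤ t ∧ u t ≤ 0} := ⟨t₀, fun t ht => ht.1⟩
  have hcl : IsClosed {t | t₀ ≤ t ∧ u t ≤ 0} :=
    (isClosed_le continuous_const continuous_id).inter (isClosed_le hcu continuous_const)
  obtain ⟨h01, hu1⟩ := hcl.csInf_mem hne hbdd
  set t₁ := sInf {t | t₀ ≤ t ∧ u t ≤ 0}
  have hlt : t₀ < t₁ := lt_of_le_of_ne h01 fun h => by rw [← h] at hu1; linarith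
  have hpos : ∀ t, t₀ ≤ t → t < t₁ → 0 < u t := fun t ht htt => by
    by_contra! hle
    exact absurd (csInf_le hbdd ⟨ht, hle⟩) (not_le.2 htt)
  have hz : u t₁ = 0 := by
    obtain ⟨s, hs, hs0⟩ := intermediate_value_Icc' h01 hcu.continuousOn ⟨hu1, hu₀.le⟩
    rcases hs.2.eq_or_lt with h | h
    · rw [← h, hs0]
    · exact absurd hs0 (hpos s hs.1 h).ne'
  have hm := hmono t₁ fun t ht => hpos t ht.1.le ht.2
  refine ⟨t₁, hlt, hz, hw₀.trans_lt (hm ⟨le_rfl, h01⟩ ⟨h01, le_rfl⟩ hlt), fun t ht => ⟨?_, ?_⟩⟩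
  · rcases ht.2.eq_or_lt with h | h
    · rw [h, hz]
    · exact (hpos t ht.1 h).le
  · exact hw₀.trans (hm.monotoneOn ⟨le_rfl, h01⟩ ht ht.1)

/-! ### Monodromic systems -/

/-- The primitive of `f` vanishing at the origin. -/
noncomputable def primitive (f : ℝ → ℝ) (x : ℝ) : ℝ := ∫ s in (0 : ℝ)..x, f s

theorem primitive_zero (f : ℝ → ℝ) : primitive f 0 = 0 := intervalIntegral.integral_same

theorem hasDerivAt_primitive {f : ℝ → ℝ} (hf : Continuous f) (x : ℝ) :
    HasDerivAt (primitive f) (f x) x :=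
  (hf.integral_hasStrictDerivAt 0 x).hasDerivAt

theorem continuous_primitive {f : ℝ → ℝ} (hf : Continuous f) : Continuous (primitive f) :=
  continuous_iff_continuousAt.2 fun x => (hasDerivAt_primitive hf x).continuousAt

theorem strictMonoOn_primitive {f : ℝ → ℝ} (hf : Continuous f) (hpos : ∀ x, 0 < x → 0 < f x) :
    StrictMonoOn (primitive f) (Set.Ici 0) := by
  refine strictMonoOn_of_deriv_pos (convex_Ici 0) (continuous_primitive hf).continuousOn
    fun x hx => ?_
  rw [interior_Ici] at hx
  rw [(hasDerivAt_primitive hf x).deriv]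
  exact hpos x hx

theorem primitive_neg {f : ℝ → ℝ} (hodd : ∀ x, f (-x) = -f x) (x : ℝ) :
    primitive f (-x) = primitive f x := by
  have h := intervalIntegral.integral_comp_neg (a := 0) (b := x) f
  simp only [hodd, intervalIntegral.integral_neg, neg_zero] at h
  rw [primitive, intervalIntegral.integral_symm, ← h, neg_neg, primitive]

theorem primitive_abs {f : ℝ → ℝ} (hodd : ∀ x, f (-x) = -f x) (x : ℝ) :
    primitive f |x| = primitive f x := by
  rcases abs_choice x with h | h <;> rw [h]
  exact primitive_neg hodd x

/-- The planar vector field `ẋ = -Y(y) q(x, y)`, `ẏ = X(x)`. -/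
def turningField (X Y : ℝ → ℝ) (q : ℝ × ℝ → ℝ) (z : ℝ × ℝ) : ℝ × ℝ := (-(Y z.2 * q z), X z.1)

/-- Conditions on `X`, `Y`, `q` under which the orbits of `turningField X Y q` turn
counterclockwise around the origin. -/
structure IsTurning (X Y : ℝ → ℝ) (q : ℝ × ℝ → ℝ) : Prop where
  continuous_X : Continuous X
  continuous_Y : Continuous Y
  monotone_X : Monotone X
  monotone_Y : Monotone Y
  odd_X : ∀ x, X (-x) = -X x
  odd_Y : ∀ y, Y (-y) = -Y y
  pos_X : ∀ x, 0 < x → 0 < X x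
  pos_Y : ∀ y, 0 < y → 0 < Y y
  le_q : ∀ z, 1 / 2 ≤ q z
  q_le : ∀ z, q z ≤ 3 / 2

/-- The energy of `ẋ = -Y(y)`, `ẏ = X(x)`. -/
noncomputable def energy (X Y : ℝ → ℝ) (z : ℝ × ℝ) : ℝ := primitive X z.1 + primitive Y z.2

namespace IsTurning

variable {X Y : ℝ → ℝ} {q : ℝ × ℝ → ℝ}

theorem zero_X (h : IsTurning X Y q) : X 0 = 0 := by
  have := h.odd_X 0
  rw [neg_zero] at this; linarith

theorem zero_Y (h : IsTurning X Y q) : Y 0 = 0 := by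
  have := h.odd_Y 0
  rw [neg_zero] at this; linarith

theorem X_eq_zero (h : IsTurning X Y q) {x : ℝ} (hx : X x = 0) : x = 0 := by
  rcases lt_trichotomy x 0 with h0 | h0 | h0
  · have := h.pos_X (-x) (by linarith)
    rw [h.odd_X] at this; linarith
  · exact h0
  · exact absurd hx (h.pos_X x h0).ne'

theorem Y_eq_zero (h : IsTurning X Y q) {y : ℝ} (hy : Y y = 0) : y = 0 := by
  rcases lt_trichotomy y 0 with h0 | h0 | h0
  · have := h.pos_Y (-y) (by linarith)
    rw [h.odd_Y] at this; linarith
  · exact h0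
  · exact absurd hy (h.pos_Y y h0).ne'

theorem primitive_X_nonneg (h : IsTurning X Y q) (x : ℝ) : 0 ≤ primitive X x := by
  rw [← primitive_abs h.odd_X, ← primitive_zero X]
  exact (strictMonoOn_primitive h.continuous_X h.pos_X).monotoneOn Set.self_mem_Ici
    (abs_nonneg x) (abs_nonneg x)

theorem primitive_Y_nonneg (h : IsTurning X Y q) (y : ℝ) : 0 ≤ primitive Y y := by
  rw [← primitive_abs h.odd_Y, ← primitive_zero Y]
  exact (strictMonoOn_primitive h.continuous_Y h.pos_Y).monotoneOn Set.self_mem_Ici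
    (abs_nonneg y) (abs_nonneg y)

theorem energy_nonneg (h : IsTurning X Y q) (z : ℝ × ℝ) : 0 ≤ energy X Y z :=
  add_nonneg (h.primitive_X_nonneg _) (h.primitive_Y_nonneg _)

theorem continuous_energy (h : IsTurning X Y q) : Continuous (energy X Y) :=
  ((continuous_primitive h.continuous_X).comp continuous_fst).add
    ((continuous_primitive h.continuous_Y).comp continuous_snd)

theorem energy_congr (h : IsTurning X Y q) {z w : ℝ × ℝ} (h1 : |z.1| = |w.1|)
    (h2 : |z.2| = |w.2|) : energy X Y z = energy X Y w := by
  rw [energy, ← primitive_abs h.odd_X, ← primitive_abs h.odd_Y, h1, h2, primitive_abs h.odd_X,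
    primitive_abs h.odd_Y, energy]

theorem abs_lt_of_energy_lt (h : IsTurning X Y q) {z : ℝ × ℝ} {r : ℝ} (hr : 0 < r)
    (hz : energy X Y z < min (primitive X r) (primitive Y r)) : |z.1| < r ∧ |z.2| < r := by
  have hx := h.primitive_X_nonneg z.1
  have hy := h.primitive_Y_nonneg z.2
  rw [lt_min_iff, energy] at hz
  constructor
  · rw [← (strictMonoOn_primitive h.continuous_X h.pos_X).lt_iff_lt
      (Set.mem_Ici.2 (abs_nonneg _)) (Set.mem_Ici.2 hr.le),
      primitive_abs h.odd_X]
    linarith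
  · rw [← (strictMonoOn_primitive h.continuous_Y h.pos_Y).lt_iff_lt
      (Set.mem_Ici.2 (abs_nonneg _)) (Set.mem_Ici.2 hr.le),
      primitive_abs h.odd_Y]
    linarith

theorem comp_neg (h : IsTurning X Y q) : IsTurning X Y (fun z => q (-z)) :=
  { h with
    le_q := fun _ => h.le_q _
    q_le := fun _ => h.q_le _ }

theorem isIntegralCurve_neg (h : IsTurning X Y q) {γ : ℝ → ℝ × ℝ}
    (hγ : IsIntegralCurve γ (fun _ => turningField X Y q)) :
    IsIntegralCurve (fun t => -γ t) (fun _ => turningField X Y (fun z => q (-z))) := by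
  intro t
  convert! (hγ t).neg using 1
  simp [turningField, h.odd_X, h.odd_Y]

theorem hasDerivAt_fst {v : ℝ × ℝ → ℝ × ℝ} {γ : ℝ → ℝ × ℝ} (hγ : IsIntegralCurve γ (fun _ => v))
    (t : ℝ) : HasDerivAt (fun t => (γ t).1) (v (γ t)).1 t :=
  (ContinuousLinearMap.fst ℝ ℝ ℝ).hasFDerivAt.comp_hasDerivAt t (hγ t)

theorem hasDerivAt_snd {v : ℝ × ℝ → ℝ × ℝ} {γ : ℝ → ℝ × ℝ} (hγ : IsIntegralCurve γ (fun _ => v))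
    (t : ℝ) : HasDerivAt (fun t => (γ t).2) (v (γ t)).2 t :=
  (ContinuousLinearMap.snd ℝ ℝ ℝ).hasFDerivAt.comp_hasDerivAt t (hγ t)

theorem hasDerivAt_energy (h : IsTurning X Y q) {γ : ℝ → ℝ × ℝ}
    (hγ : IsIntegralCurve γ (fun _ => turningField X Y q)) (k t : ℝ) :
    HasDerivAt (fun t => k * primitive X (γ t).1 + primitive Y (γ t).2)
      (X (γ t).1 * Y (γ t).2 * (1 - k * q (γ t))) t := by
  have h1 := ((hasDerivAt_primitive h.continuous_X (γ t).1).comp t (hasDerivAt_fst hγ t)).const_mul k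
  have h2 := (hasDerivAt_primitive h.continuous_Y (γ t).2).comp t (hasDerivAt_snd hγ t)
  convert! h1.add h2 using 1
  simp only [turningField]; ring

/-- Along an orbit on `[s, t]` the energy grows at most by the factor `2 ^ n`. -/
def Reach (X Y : ℝ → ℝ) (γ : ℝ → ℝ × ℝ) (n : ℕ) (s t : ℝ) : Prop :=
  s < t ∧ ∀ τ ∈ Set.Icc s t, energy X Y (γ τ) ≤ 2 ^ n * energy X Y (γ s)

theorem Reach.trans (h : IsTurning X Y q) {γ : ℝ → ℝ × ℝ} {m n : ℕ} {s t u : ℝ}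
    (h1 : Reach X Y γ m s t) (h2 : Reach X Y γ n t u) : Reach X Y γ (m + n) s u := by
  refine ⟨h1.1.trans h2.1, fun τ hτ => ?_⟩
  have hE := h.energy_nonneg (γ s)
  rcases le_total τ t with hle | hle
  · refine (h1.2 τ ⟨hτ.1, hle⟩).trans (mul_le_mul_of_nonneg_right ?_ hE)
    exact pow_le_pow_right₀ (by norm_num) (by omega)
  · refine (h2.2 τ ⟨hle, hτ.2⟩).trans ?_
    rw [pow_add, mul_comm (2 ^ m : ℝ), mul_assoc]
    exact mul_le_mul_of_nonneg_left (h1.2 t ⟨h1.1.le, le_rfl⟩) (by positivity)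

theorem Reach.mono (h : IsTurning X Y q) {γ : ℝ → ℝ × ℝ} {m n : ℕ} {s t : ℝ}
    (h1 : Reach X Y γ m s t) (hmn : m ≤ n) : Reach X Y γ n s t :=
  ⟨h1.1, fun τ hτ => (h1.2 τ hτ).trans (mul_le_mul_of_nonneg_right
    (pow_le_pow_right₀ (by norm_num) hmn) (h.energy_nonneg _))⟩

theorem reach_of_sign (h : IsTurning X Y q) {γ : ℝ → ℝ × ℝ}
    (hγ : IsIntegralCurve γ (fun _ => turningField X Y q)) {s t k : ℝ} (hst : s < t)
    (hk : 0 < k)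
    (hs : ∀ τ ∈ Set.Icc s t, X (γ τ).1 * Y (γ τ).2 * (1 - k * q (γ τ)) ≤ 0)
    (hE : k * primitive X (γ s).1 + primitive Y (γ s).2 ≤ min 1 k * (2 * energy X Y (γ s))) :
    Reach X Y γ 1 s t := by
  refine ⟨hst, fun τ hτ => ?_⟩
  have hanti : AntitoneOn (fun t => k * primitive X (γ t).1 + primitive Y (γ t).2)
      (Set.Icc s t) := by
    refine antitoneOn_of_deriv_nonpos (convex_Icc _ _)
      (fun τ _ => (h.hasDerivAt_energy hγ k τ).continuousAt.continuousWithinAt)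
      (fun τ _ => (h.hasDerivAt_energy hγ k τ).differentiableAt.differentiableWithinAt)
      fun τ hτ => ?_
    rw [(h.hasDerivAt_energy hγ k τ).deriv]
    exact hs τ (interior_subset hτ)
  have h1 := (hanti ⟨le_rfl, hst.le⟩ hτ hτ.1).trans hE
  have hx := h.primitive_X_nonneg (γ τ).1
  have hy := h.primitive_Y_nonneg (γ τ).2
  have hm : 0 < min 1 k := lt_min one_pos hk
  have h2 : min 1 k * energy X Y (γ τ) ≤ min 1 k * (2 * energy X Y (γ s)) := by
    refine le_trans ?_ h1
    have ha := mul_le_mul_of_nonneg_right (min_le_right 1 k) hx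
    have hb := mul_le_mul_of_nonneg_right (min_le_left 1 k) hy
    simp only [energy, mul_add]; linarith
  rw [pow_one]
  exact le_of_mul_le_mul_left h2 hm

theorem reach_fst_zero (h : IsTurning X Y q) {γ : ℝ → ℝ × ℝ}
    (hγ : IsIntegralCurve γ (fun _ => turningField X Y q)) {s : ℝ} (hx : 0 < (γ s).1)
    (hy : 0 ≤ (γ s).2) : ∃ t, (γ t).1 = 0 ∧ 0 < (γ t).2 ∧ Reach X Y γ 1 s t := by
  obtain ⟨t, hst, h1, h2, h3⟩ := exists_first_zero (u := fun t => (γ t).1)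
    (w := fun t => (γ t).2) (a := fun t => Y (γ t).2 * q (γ t)) (b := fun t => X (γ t).1)
    (φ := fun c => Y c * (1 / 2)) (hasDerivAt_fst hγ) (hasDerivAt_snd hγ)
    (fun t => h.pos_X _)
    (fun t c hc hct => mul_le_mul (h.monotone_Y hct) (h.le_q _) (by norm_num)
      ((h.pos_Y c hc).le.trans (h.monotone_Y hct)))
    (fun c hc => mul_pos (h.pos_Y c hc) (by norm_num)) hx hy
  refine ⟨t, h1, h2, h.reach_of_sign hγ hst (k := 2) two_pos (fun τ hτ => ?_) ?_⟩
  · have hX : 0 ≤ X (γ τ).1 := by rw [← h.zero_X]; exact h.monotone_X (h3 τ hτ).1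
    have hY : 0 ≤ Y (γ τ).2 := by rw [← h.zero_Y]; exact h.monotone_Y (h3 τ hτ).2
    exact mul_nonpos_of_nonneg_of_nonpos (mul_nonneg hX hY) (by linarith [h.le_q (γ τ)])
  · have := h.primitive_Y_nonneg (γ s).2
    rw [min_eq_left (by norm_num), energy]; linarith

theorem reach_snd_zero (h : IsTurning X Y q) {γ : ℝ → ℝ × ℝ}
    (hγ : IsIntegralCurve γ (fun _ => turningField X Y q)) {s : ℝ} (hx : (γ s).1 ≤ 0)
    (hy : 0 < (γ s).2) : ∃ t, (γ t).2 = 0 ∧ (γ t).1 < 0 ∧ Reach X Y γ 1 s t := by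
  obtain ⟨t, hst, h1, h2, h3⟩ := exists_first_zero (u := fun t => (γ t).2)
    (w := fun t => -(γ t).1) (a := fun t => -X (γ t).1) (b := fun t => Y (γ t).2 * q (γ t))
    (φ := X) (fun t => by simpa using! hasDerivAt_snd hγ t)
    (fun t => by simpa [turningField] using! (hasDerivAt_fst hγ t).neg)
    (fun t ht => mul_pos (h.pos_Y _ ht) (by linarith [h.le_q (γ t)]))
    (fun t c hc hct => by rw [← h.odd_X]; exact h.monotone_X hct) h.pos_X hy
    (by linarith)
  refine ⟨t, h1, by linarith, h.reach_of_sign hγ hst (k := 2 / 3) (by norm_num)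
    (fun τ hτ => ?_) ?_⟩
  · have hX : X (γ τ).1 ≤ 0 := by
      rw [← h.zero_X]; exact h.monotone_X (by linarith [(h3 τ hτ).2])
    have hY : 0 ≤ Y (γ τ).2 := by rw [← h.zero_Y]; exact h.monotone_Y (h3 τ hτ).1
    exact mul_nonpos_of_nonpos_of_nonneg (mul_nonpos_of_nonpos_of_nonneg hX hY)
      (by linarith [h.q_le (γ τ)])
  · have := h.primitive_Y_nonneg (γ s).2
    have := h.primitive_X_nonneg (γ s).1
    rw [min_eq_right (by norm_num), energy]; linarith

theorem Reach.of_neg (h : IsTurning X Y q) {γ : ℝ → ℝ × ℝ} {n : ℕ} {s t : ℝ}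
    (hr : Reach X Y (fun t => -γ t) n s t) : Reach X Y γ n s t := by
  have hE : ∀ τ, energy X Y (-γ τ) = energy X Y (γ τ) := fun τ =>
    h.energy_congr (by simp) (by simp)
  simpa only [Reach, hE] using hr

theorem reach_fst_zero' (h : IsTurning X Y q) {γ : ℝ → ℝ × ℝ}
    (hγ : IsIntegralCurve γ (fun _ => turningField X Y q)) {s : ℝ} (hx : (γ s).1 < 0)
    (hy : (γ s).2 ≤ 0) : ∃ t, (γ t).1 = 0 ∧ (γ t).2 < 0 ∧ Reach X Y γ 1 s t := by
  obtain ⟨t, h1, h2, h3⟩ := h.comp_neg.reach_fst_zero (h.isIntegralCurve_neg hγ) (s := s)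
    (by simpa using hx) (by simpa using hy)
  exact ⟨t, by simpa using h1, by simpa using h2, Reach.of_neg h h3⟩

theorem reach_snd_zero' (h : IsTurning X Y q) {γ : ℝ → ℝ × ℝ}
    (hγ : IsIntegralCurve γ (fun _ => turningField X Y q)) {s : ℝ} (hx : 0 ≤ (γ s).1)
    (hy : (γ s).2 < 0) : ∃ t, (γ t).2 = 0 ∧ 0 < (γ t).1 ∧ Reach X Y γ 1 s t := by
  obtain ⟨t, h1, h2, h3⟩ := h.comp_neg.reach_snd_zero (h.isIntegralCurve_neg hγ) (s := s)
    (by simpa using hx) (by simpa using hy)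
  exact ⟨t, by simpa using h1, by simpa using h2, Reach.of_neg h h3⟩

/-- Every orbit other than the origin reaches the positive `y`-axis. -/
theorem reach_posY (h : IsTurning X Y q) {γ : ℝ → ℝ × ℝ}
    (hγ : IsIntegralCurve γ (fun _ => turningField X Y q)) {s : ℝ} (hs : γ s ≠ 0) :
    ∃ t, (γ t).1 = 0 ∧ 0 < (γ t).2 ∧ Reach X Y γ 4 s t := by
  have q1 : ∀ s, 0 < (γ s).1 → 0 ≤ (γ s).2 →
      ∃ t, (γ t).1 = 0 ∧ 0 < (γ t).2 ∧ Reach X Y γ 1 s t := fun s => h.reach_fst_zero hγ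
  have q4 : ∀ s, 0 ≤ (γ s).1 → (γ s).2 < 0 →
      ∃ t, (γ t).1 = 0 ∧ 0 < (γ t).2 ∧ Reach X Y γ 2 s t := fun s hx hy => by
    obtain ⟨t, ht1, ht2, ht⟩ := h.reach_snd_zero' hγ hx hy
    obtain ⟨u, hu1, hu2, hu⟩ := q1 t ht2 ht1.ge
    exact ⟨u, hu1, hu2, ht.trans h hu⟩
  have q3 : ∀ s, (γ s).1 < 0 → (γ s).2 ≤ 0 →
      ∃ t, (γ t).1 = 0 ∧ 0 < (γ t).2 ∧ Reach X Y γ 3 s t := fun s hx hy => by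
    obtain ⟨t, ht1, ht2, ht⟩ := h.reach_fst_zero' hγ hx hy
    obtain ⟨u, hu1, hu2, hu⟩ := q4 t ht1.ge ht2
    exact ⟨u, hu1, hu2, ht.trans h hu⟩
  have q2 : ∀ s, (γ s).1 ≤ 0 → 0 < (γ s).2 →
      ∃ t, (γ t).1 = 0 ∧ 0 < (γ t).2 ∧ Reach X Y γ 4 s t := fun s hx hy => by
    obtain ⟨t, ht1, ht2, ht⟩ := h.reach_snd_zero hγ hx hy
    obtain ⟨u, hu1, hu2, hu⟩ := q3 t ht2 ht1.le
    exact ⟨u, hu1, hu2, ht.trans h hu⟩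
  have weaken : ∀ n ≤ 4, (∃ t, (γ t).1 = 0 ∧ 0 < (γ t).2 ∧ Reach X Y γ n s t) →
      ∃ t, (γ t).1 = 0 ∧ 0 < (γ t).2 ∧ Reach X Y γ 4 s t := fun n hn ⟨t, h1, h2, h3⟩ =>
    ⟨t, h1, h2, h3.mono h hn⟩
  rcases lt_trichotomy (γ s).1 0 with hx | hx | hx
  · rcases le_or_gt (γ s).2 0 with hy | hy
    · exact weaken 3 (by norm_num) (q3 s hx hy)
    · exact q2 s hx.le hy
  · rcases lt_trichotomy (γ s).2 0 with hy | hy | hy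
    · exact weaken 2 (by norm_num) (q4 s hx.ge hy)
    · exact absurd (Prod.ext hx hy) hs
    · exact q2 s hx.le hy
  · rcases le_or_gt 0 (γ s).2 with hy | hy
    · exact weaken 1 (by norm_num) (q1 s hx hy)
    · exact weaken 2 (by norm_num) (q4 s hx.le hy)

/-- An orbit starting on the positive `y`-axis meets the negative `y`-axis. -/
theorem reach_negY (h : IsTurning X Y q) {γ : ℝ → ℝ × ℝ}
    (hγ : IsIntegralCurve γ (fun _ => turningField X Y q)) {s : ℝ} (hx : (γ s).1 = 0)
    (hy : 0 < (γ s).2) : ∃ t, (γ t).1 = 0 ∧ Reach X Y γ 2 s t := by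
  obtain ⟨t, ht1, ht2, ht⟩ := h.reach_snd_zero hγ hx.le hy
  obtain ⟨u, hu1, -, hu⟩ := h.reach_fst_zero' hγ ht2 ht1.le
  exact ⟨u, hu1, ht.trans h hu⟩

/-- An orbit starting on the positive `y`-axis meets the `x`-axis twice. -/
theorem reach_snd_zero_twice (h : IsTurning X Y q) {γ : ℝ → ℝ × ℝ}
    (hγ : IsIntegralCurve γ (fun _ => turningField X Y q)) {s : ℝ} (hx : (γ s).1 = 0)
    (hy : 0 < (γ s).2) :
    ∃ t u, (γ t).2 = 0 ∧ (γ u).2 = 0 ∧ Reach X Y γ 1 s t ∧ Reach X Y γ 2 t u := by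
  obtain ⟨t, ht1, ht2, ht⟩ := h.reach_snd_zero hγ hx.le hy
  obtain ⟨u, hu1, hu2, hu⟩ := h.reach_fst_zero' hγ ht2 ht1.le
  obtain ⟨w, hw1, -, hw⟩ := h.reach_snd_zero' hγ hu1.ge hu2
  exact ⟨t, w, ht1, hw1, ht, hu.trans h hw⟩

end IsTurning

namespace IsTurning

variable {X Y : ℝ → ℝ} {q : ℝ × ℝ → ℝ}

/-- An orbit of a reversible system which meets the fixed set of the reversor twice is
periodic. -/
theorem periodic_of_reversor (h : IsTurning X Y q) {K : NNReal}
    (hK : LipschitzWith K (turningField X Y q)) (R : (ℝ × ℝ) →L[ℝ] (ℝ × ℝ))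
    (hR : ∀ z, turningField X Y q (R z) = -R (turningField X Y q z))
    (hRE : ∀ z, energy X Y (R z) = energy X Y z) {γ : ℝ → ℝ × ℝ}
    (hγ : IsIntegralCurve γ (fun _ => turningField X Y q)) {m n : ℕ} {s t u : ℝ}
    (ht : R (γ t) = γ t) (hu : R (γ u) = γ u) (hst : Reach X Y γ m s t)
    (htu : Reach X Y γ n t u) :
    ∃ T, 0 < T ∧ Function.Periodic γ T ∧
      ∀ τ, energy X Y (γ τ) ≤ 2 ^ (m + n) * energy X Y (γ s) := by
  have hrev : IsIntegralCurve (fun τ => R (γ (2 * t - τ))) (fun _ => turningField X Y q) := by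
    intro τ
    have h1 : HasDerivAt (fun τ => γ (2 * t - τ)) (-turningField X Y q (γ (2 * t - τ))) τ := by
      have h2 := HasDerivAt.scomp τ (hγ (2 * t - τ)) ((hasDerivAt_id τ).const_sub (2 * t))
      simpa using! h2
    have h3 := R.hasFDerivAt.comp_hasDerivAt τ h1
    rw [map_neg, ← hR] at h3
    exact h3
  have hsymm : ∀ τ, R (γ (2 * t - τ)) = γ τ := fun τ =>
    congrFun (isIntegralCurve_eq_of_lipschitzWith hK hrev hγ (t₀ := t)
      (by rw [two_mul, add_sub_cancel_right, ht])) τ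
  have hper : Function.Periodic γ (u - (2 * t - u)) := by
    refine periodic_of_return hK hγ ?_
    rw [← hsymm (2 * t - u), sub_sub_cancel, hu]
  have hT : 0 < u - (2 * t - u) := by linarith [htu.1]
  refine ⟨_, hT, hper, fun τ => ?_⟩
  have hbd : ∀ σ, t ≤ σ → σ ≤ u → energy X Y (γ σ) ≤ 2 ^ (m + n) * energy X Y (γ s) :=
    fun σ h1 h2 => (hst.trans h htu).2 σ ⟨hst.1.le.trans h1, h2⟩
  obtain ⟨σ, hσ, hσ'⟩ := hper.exists_mem_Ico hT τ (2 * t - u)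
  rw [hσ']
  rw [add_sub_cancel] at hσ
  rcases le_total t σ with hle | hle
  · exact hbd σ hle hσ.2.le
  · rw [← hsymm σ, hRE]
    exact hbd _ (by linarith) (by linarith [hσ.1])

theorem periodic_of_even_fst (h : IsTurning X Y q) {K : NNReal}
    (hK : LipschitzWith K (turningField X Y q)) (hq : ∀ x y, q (-x, y) = q (x, y))
    {γ : ℝ → ℝ × ℝ} (hγ : IsIntegralCurve γ (fun _ => turningField X Y q)) (h0 : γ 0 ≠ 0) :
    ∃ T, 0 < T ∧ Function.Periodic γ T ∧
      ∀ τ, energy X Y (γ τ) ≤ 2 ^ 8 * energy X Y (γ 0) := by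
  obtain ⟨t, ht1, ht2, ht⟩ := h.reach_posY hγ h0
  obtain ⟨u, hu1, hu⟩ := h.reach_negY hγ ht1 ht2
  refine h.periodic_of_reversor hK
    ((-ContinuousLinearMap.fst ℝ ℝ ℝ).prod (ContinuousLinearMap.snd ℝ ℝ ℝ)) (fun z => ?_)
    (fun z => h.energy_congr (by simp) (by simp)) hγ ?_ ?_ ht (hu.mono h (n := 4) (by norm_num))
  · have := hq z.1 z.2
    simp [turningField, this, h.odd_X]
  · ext <;> simp [ht1]
  · ext <;> simp [hu1]

theorem periodic_of_even_snd (h : IsTurning X Y q) {K : NNReal}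
    (hK : LipschitzWith K (turningField X Y q)) (hq : ∀ x y, q (x, -y) = q (x, y))
    {γ : ℝ → ℝ × ℝ} (hγ : IsIntegralCurve γ (fun _ => turningField X Y q)) (h0 : γ 0 ≠ 0) :
    ∃ T, 0 < T ∧ Function.Periodic γ T ∧
      ∀ τ, energy X Y (γ τ) ≤ 2 ^ 8 * energy X Y (γ 0) := by
  obtain ⟨t, ht1, ht2, ht⟩ := h.reach_posY hγ h0
  obtain ⟨u, w, hu, hw, htu, huw⟩ := h.reach_snd_zero_twice hγ ht1 ht2
  refine h.periodic_of_reversor hK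
    ((ContinuousLinearMap.fst ℝ ℝ ℝ).prod (-ContinuousLinearMap.snd ℝ ℝ ℝ)) (fun z => ?_)
    (fun z => h.energy_congr (by simp) (by simp)) hγ ?_ ?_ (ht.trans h htu)
    (huw.mono h (n := 3) (by norm_num))
  · have := hq z.1 z.2
    simp [turningField, this, h.odd_Y]
  · ext <;> simp [hu]
  · ext <;> simp [hw]

theorem periodic_of_separable (h : IsTurning X Y q) {K : NNReal}
    (hK : LipschitzWith K (turningField X Y q)) {α β : ℝ → ℝ} (hα : Continuous α)
    (hβ : Continuous β) (hα0 : ∀ x, 0 < α x) (hβ0 : ∀ y, 0 < β y)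
    (hq : ∀ z, q z = α z.1 * β z.2)
    {γ : ℝ → ℝ × ℝ} (hγ : IsIntegralCurve γ (fun _ => turningField X Y q)) (h0 : γ 0 ≠ 0) :
    ∃ T, 0 < T ∧ Function.Periodic γ T ∧
      ∀ τ, energy X Y (γ τ) ≤ 2 ^ 8 * energy X Y (γ 0) := by
  obtain ⟨t, ht1, ht2, ht⟩ := h.reach_posY hγ h0
  obtain ⟨u, hu1, hu2, hu⟩ := h.reach_posY hγ (s := t) (fun h => by rw [h] at ht2; simp at ht2)
  have hf : Continuous fun x => X x / α x := h.continuous_X.div hα fun x => (hα0 x).ne'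
  have hg : Continuous fun y => Y y * β y := h.continuous_Y.mul hβ
  have hconst : ∀ τ, HasDerivAt (fun τ => primitive (fun x => X x / α x) (γ τ).1 +
      primitive (fun y => Y y * β y) (γ τ).2) 0 τ := by
    intro τ
    have h1 := (hasDerivAt_primitive hf (γ τ).1).comp τ (hasDerivAt_fst hγ τ)
    have h2 := (hasDerivAt_primitive hg (γ τ).2).comp τ (hasDerivAt_snd hγ τ)
    convert! h1.add h2 using 1
    have := (hα0 (γ τ).1).ne'
    simp only [turningField, hq]
    field_simp; ring
  have hEq := is_const_of_deriv_eq_zero (fun τ => (hconst τ).differentiableAt)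
    (fun τ => (hconst τ).deriv) t u
  simp only [ht1, hu1, add_right_inj] at hEq
  have htu : γ t = γ u := Prod.ext (ht1.trans hu1.symm)
    ((strictMonoOn_primitive hg fun y hy => mul_pos (h.pos_Y y hy) (hβ0 y)).injOn
      (Set.mem_Ici.2 ht2.le) (Set.mem_Ici.2 hu2.le) hEq)
  have hper := periodic_of_return hK hγ htu
  refine ⟨_, sub_pos.2 hu.1, hper, fun τ => ?_⟩
  obtain ⟨σ, hσ, hσ'⟩ := hper.exists_mem_Ico (sub_pos.2 hu.1) τ t
  rw [add_sub_cancel] at hσ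
  rw [hσ']
  exact (ht.trans h hu).2 σ ⟨ht.1.le.trans hσ.1, hσ.2.le⟩

/-- If all orbits of a monodromic system are periodic and stay close to the origin, then every
system that agrees with it near the origin has a center. -/
theorem isCenter_of_periodic (h : IsTurning X Y q) {K L : NNReal}
    (hK : LipschitzWith K (turningField X Y q)) (hL : ∀ z, ‖turningField X Y q z‖ ≤ L)
    {v : ℝ × ℝ → ℝ × ℝ} {m : ℝ} (hm : 0 < m)
    (hv : ∀ z, energy X Y z < m → v z = turningField X Y q z)
    (hper : ∀ γ : ℝ → ℝ × ℝ, IsIntegralCurve γ (fun _ => turningField X Y q) → γ 0 ≠ 0 →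
      ∃ T, 0 < T ∧ Function.Periodic γ T ∧
        ∀ τ, energy X Y (γ τ) ≤ 2 ^ 8 * energy X Y (γ 0)) :
    IsCenter v 0 := by
  have hE0 : energy X Y 0 = 0 := by simp [energy, primitive_zero]
  have hf0 : turningField X Y q 0 = 0 := by simp [turningField, h.zero_X, h.zero_Y]
  refine ⟨by rw [hv 0 (by rwa [hE0]), hf0], insert 0 {z | HasPeriodicOrbitIn v z {0}ᶜ}, ?_, ?_⟩
  · have hnear : ∀ᶠ z in 𝓝 (0 : ℝ × ℝ), 2 ^ 8 * energy X Y z < m := by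
      refine (continuous_const.mul h.continuous_energy).continuousAt.eventually_lt
        continuousAt_const ?_
      simpa [hE0] using hm
    filter_upwards [hnear] with z hz
    rcases eq_or_ne z 0 with rfl | hz0
    · exact Set.mem_insert _ _
    refine Set.mem_insert_of_mem _ ?_
    obtain ⟨γ, hγ, rfl⟩ := exists_isIntegralCurve_of_lipschitzWith hK hL z
    obtain ⟨T, hT, hperT, hbd⟩ := hper γ hγ hz0
    refine ⟨γ, fun t => ?_, rfl, ⟨T, hT, hperT⟩, ?_, fun t ht => hz0 ?_⟩
    · have := hγ t
      beta_reduce at this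
      rwa [← hv _ ((hbd t).trans_lt hz)] at this
    · by_contra! hc
      have hconst : HasDerivAt γ 0 0 := by
        rw [show γ = fun _ => γ 0 from funext hc]
        exact hasDerivAt_const _ _
      have h1 := hconst.unique (hγ 0)
      simp only [turningField, Prod.ext_iff, Prod.fst_zero, Prod.snd_zero] at h1
      have hx := h.X_eq_zero h1.2.symm
      have hq : q (γ 0) ≠ 0 := by linarith [h.le_q (γ 0)]
      have hy : Y (γ 0).2 = 0 := by
        rcases mul_eq_zero.1 (neg_eq_zero.1 h1.1.symm) with h2 | h2
        · exact h2
        · exact absurd h2 hq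
      exact hz0 (Prod.ext hx (h.Y_eq_zero hy))
    · have h0 : IsIntegralCurve (fun _ : ℝ => (0 : ℝ × ℝ)) (fun _ => turningField X Y q) :=
        isIntegralCurve_const fun _ => hf0
      rw [isIntegralCurve_eq_of_lipschitzWith hK hγ h0 ht]
  · rintro z ⟨hz, hz0⟩
    obtain ⟨γ, hγ, h0, ⟨T, hT, hperT⟩, ⟨s, hs⟩, hne⟩ := hz.resolve_left hz0
    refine ⟨γ, hγ, h0, ⟨T, hT, hperT⟩, ⟨s, hs⟩, fun t => ⟨Set.mem_insert_of_mem _ ?_, hne t⟩⟩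
    refine ⟨γ ∘ (· + t), hγ.comp_add t, by simp, ⟨T, hT, fun τ => ?_⟩, ?_,
      fun τ => hne _⟩
    · have := hperT (τ + t)
      simpa [add_right_comm] using this
    · by_contra! hc
      have h1 := hc (s - t)
      have h2 := hc (-t)
      simp only [Function.comp_apply, sub_add_cancel, neg_add_cancel] at h1 h2
      exact hs (by rw [h1, ← h2, h0])

end IsTurning

/-! ### Truncation -/

/-- Projection of the real line to `[-r, r]`. -/
noncomputable def clamp (r x : ℝ) : ℝ := max (-r) (min x r)

theorem clamp_of_abs_le {r x : ℝ} (h : |x| ≤ r) : clamp r x = x := by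
  rw [abs_le] at h
  rw [clamp, min_eq_left h.2, max_eq_right h.1]

theorem abs_clamp_le {r : ℝ} (hr : 0 ≤ r) (x : ℝ) : |clamp r x| ≤ r :=
  abs_le.2 ⟨le_max_left _ _, max_le (by linarith) (min_le_right _ _)⟩

theorem lipschitzWith_clamp (r : ℝ) : LipschitzWith 1 (clamp r) :=
  (LipschitzWith.id.min_const r).const_max (-r)

theorem monotone_clamp (r : ℝ) : Monotone (clamp r) := fun _ _ h =>
  max_le_max le_rfl (min_le_min h le_rfl)

theorem clamp_neg {r : ℝ} (hr : 0 ≤ r) (x : ℝ) : clamp r (-x) = -clamp r x := by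
  simp only [clamp, max_def, min_def]
  split_ifs <;> linarith

theorem clamp_pos {r x : ℝ} (hr : 0 < r) (hx : 0 < x) : 0 < clamp r x :=
  lt_max_of_lt_right (lt_min hx hr)

/-- The system `ẋ = -y p(x, y)`, `ẏ = x³` with `p` smooth and `p(0, 0) = 1` has a center at the
origin if `p` is even in `x`, or even in `y`, or a product of functions of one variable. -/
theorem isCenter_of_symmetric {p : ℝ × ℝ → ℝ} (hp : ContDiff ℝ 1 p) (hp0 : p 0 = 1)
    (hsymm : (∀ x y, p (-x, y) = p (x, y)) ∨ (∀ x y, p (x, -y) = p (x, y)) ∨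
      ∃ α β : ℝ → ℝ, Continuous α ∧ Continuous β ∧ α 0 = 1 ∧ β 0 = 1 ∧
        ∀ z, p z = α z.1 * β z.2) :
    IsCenter (fun z : ℝ × ℝ => (-(z.2 * p z), z.1 ^ 3)) 0 := by
  have hnear : ∀ {f : ℝ × ℝ → ℝ}, Continuous f → f 0 = 1 →
      ∀ᶠ z in 𝓝 (0 : ℝ × ℝ), 1 / 2 ≤ f z ∧ f z ≤ 3 / 2 := by
    intro f hf hf0
    have : ∀ᶠ z in 𝓝 (0 : ℝ × ℝ), f z ∈ Set.Icc (1 / 2 : ℝ) (3 / 2) :=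
      hf.continuousAt.eventually_mem (by rw [hf0]; exact Icc_mem_nhds (by norm_num) (by norm_num))
    exact this
  have hbox : ∀ {Q : ℝ × ℝ → Prop}, (∀ᶠ z in 𝓝 (0 : ℝ × ℝ), Q z) →
      ∀ᶠ r in 𝓝[>] (0 : ℝ), ∀ z : ℝ × ℝ, |z.1| ≤ r → |z.2| ≤ r → Q z := by
    intro Q hQ
    obtain ⟨ε, hε, h⟩ := Metric.eventually_nhds_iff.1 hQ
    filter_upwards [Ioo_mem_nhdsGT hε] with r hr z h1 h2
    refine h ?_
    rw [dist_zero_right, Prod.norm_def]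
    exact (max_le h1 h2).trans_lt hr.2
  have main : ∀ r : ℝ, 0 < r → (∀ z : ℝ × ℝ, |z.1| ≤ r → |z.2| ≤ r → 1 / 2 ≤ p z ∧ p z ≤ 3 / 2) →
      ((∀ x y, p (-x, y) = p (x, y)) ∨ (∀ x y, p (x, -y) = p (x, y)) ∨
        ∃ α β : ℝ → ℝ, Continuous α ∧ Continuous β ∧
          (∀ x, |x| ≤ r → 0 < α x) ∧ (∀ y, |y| ≤ r → 0 < β y) ∧ ∀ z, p z = α z.1 * β z.2) →
      IsCenter (fun z : ℝ × ℝ => (-(z.2 * p z), z.1 ^ 3)) 0 := by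
    intro r hr hpr hs
    have habs := abs_clamp_le hr.le
    have hcc : Continuous (clamp r) := (lipschitzWith_clamp r).continuous
    let q : ℝ × ℝ → ℝ := fun z => p (clamp r z.1, clamp r z.2)
    have h : IsTurning (fun x => clamp r x ^ 3) (clamp r) q :=
      { continuous_X := hcc.pow 3
        continuous_Y := hcc
        monotone_X := fun x y hxy => (Odd.strictMono_pow (by decide)).monotone
          (monotone_clamp r hxy)
        monotone_Y := monotone_clamp r
        odd_X := fun x => by rw [clamp_neg hr.le]; ring
        odd_Y := clamp_neg hr.le
        pos_X := fun x hx => pow_pos (clamp_pos hr hx) 3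
        pos_Y := fun y => clamp_pos hr
        le_q := fun z => (hpr _ (habs _) (habs _)).1
        q_le := fun z => (hpr _ (habs _) (habs _)).2 }
    have hcl : LipschitzWith 1 fun z : ℝ × ℝ => (clamp r z.1, clamp r z.2) := by
      have := ((lipschitzWith_clamp r).comp LipschitzWith.prod_fst).prodMk
        ((lipschitzWith_clamp r).comp LipschitzWith.prod_snd)
      simpa using! this
    have hv : ContDiff ℝ 1 fun z : ℝ × ℝ => (-(z.2 * p z), z.1 ^ 3) := by fun_prop
    have hcomp : IsCompact (Set.Icc (-r) r ×ˢ Set.Icc (-r) r) := isCompact_Icc.prod isCompact_Icc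
    have hconv : Convex ℝ (Set.Icc (-r) r ×ˢ Set.Icc (-r) r) :=
      (convex_Icc _ _).prod (convex_Icc _ _)
    have hmaps : ∀ z : ℝ × ℝ,
        (clamp r z.1, clamp r z.2) ∈ Set.Icc (-r) r ×ˢ Set.Icc (-r) r := fun z =>
      ⟨abs_le.1 (habs _), abs_le.1 (habs _)⟩
    obtain ⟨K, hK⟩ := hv.contDiffOn.exists_lipschitzOnWith one_ne_zero hconv hcomp
    have hK' : LipschitzWith K (turningField (fun x => clamp r x ^ 3) (clamp r) q) := by
      have := hK.comp (hcl.lipschitzOnWith (s := Set.univ)) fun z _ => hmaps z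
      rw [mul_one, lipschitzOnWith_univ] at this
      exact this
    obtain ⟨L, hL⟩ := hcomp.exists_bound_of_continuousOn hv.continuous.continuousOn
    have hL' : ∀ z, ‖turningField (fun x => clamp r x ^ 3) (clamp r) q z‖ ≤ L.toNNReal := fun z =>
      (hL _ (hmaps z)).trans (Real.le_coe_toNNReal L)
    refine h.isCenter_of_periodic hK' hL' (m := min (primitive (fun x => clamp r x ^ 3) r)
      (primitive (clamp r) r)) ?_ (fun z hz => ?_) fun γ hγ h0 => ?_
    · have h1 := strictMonoOn_primitive h.continuous_X h.pos_X Set.self_mem_Ici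
        (Set.mem_Ici.2 hr.le) hr
      have h2 := strictMonoOn_primitive h.continuous_Y h.pos_Y Set.self_mem_Ici
        (Set.mem_Ici.2 hr.le) hr
      rw [primitive_zero] at h1 h2
      exact lt_min h1 h2
    · obtain ⟨h1, h2⟩ := h.abs_lt_of_energy_lt hr hz
      simp only [turningField, q, clamp_of_abs_le h1.le, clamp_of_abs_le h2.le]
    · rcases hs with hs | hs | ⟨α, β, hα, hβ, hα0, hβ0, hs⟩
      · exact h.periodic_of_even_fst hK' (fun x y => by simp only [q, clamp_neg hr.le, hs]) hγ h0
      · exact h.periodic_of_even_snd hK' (fun x y => by simp only [q, clamp_neg hr.le, hs]) hγ h0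
      · exact h.periodic_of_separable hK' (hα.comp hcc) (hβ.comp hcc)
          (fun x => hα0 _ (habs x)) (fun y => hβ0 _ (habs y)) (fun z => hs _) hγ h0
  have hpev := hbox (hnear hp.continuous hp0)
  rcases hsymm with hs | hs | ⟨α, β, hα, hβ, hα0, hβ0, hs⟩
  · obtain ⟨r, h1, hr⟩ := (hpev.and self_mem_nhdsWithin).exists
    exact main r hr h1 (Or.inl hs)
  · obtain ⟨r, h1, hr⟩ := (hpev.and self_mem_nhdsWithin).exists
    exact main r hr h1 (Or.inr (Or.inl hs))
  · obtain ⟨r, ⟨h1, h2, h3⟩, hr⟩ := ((hpev.and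
      ((hbox (hnear (hα.comp continuous_fst) hα0)).and
        (hbox (hnear (hβ.comp continuous_snd) hβ0)))).and self_mem_nhdsWithin).exists
    have hr0 : |(0 : ℝ)| ≤ r := by rw [abs_zero]; exact le_of_lt hr
    exact main r hr h1 (Or.inr (Or.inr ⟨α, β, hα, hβ,
      fun x hx => lt_of_lt_of_le (by norm_num) (h2 (x, 0) hx hr0).1,
      fun y hy => lt_of_lt_of_le (by norm_num) (h3 (0, y) hr0 hy).1, hs⟩))

theorem IsAnalyticHigherOrder.mul_of_eq_zero {f g : ℝ × ℝ → ℝ} (hf : AnalyticAt ℝ f 0)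
    (hg : AnalyticAt ℝ g 0) (hf0 : f 0 = 0) (hg0 : g 0 = 0) :
    IsAnalyticHigherOrder fun z => f z * g z := by
  refine ⟨hf.mul hg, by simp [hf0], ?_⟩
  rw [fderiv_fun_mul hf.differentiableAt hg.differentiableAt, hf0, hg0, zero_smul, zero_smul,
    add_zero]

theorem IsAnalyticHigherOrder.add {f g : ℝ × ℝ → ℝ} (hf : IsAnalyticHigherOrder f)
    (hg : IsAnalyticHigherOrder g) : IsAnalyticHigherOrder fun z => f z + g z := by
  refine ⟨hf.1.add hg.1, by simp [hf.2.1, hg.2.1], ?_⟩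
  rw [fderiv_fun_add hf.1.differentiableAt hg.1.differentiableAt, hf.2.2, hg.2.2, add_zero]

theorem hasNilpotentForm_cubicField (a₁₁ a₀₂ a₃₀ a₂₁ a₁₂ a₀₃ : ℝ) :
    HasNilpotentForm (cubicField a₁₁ a₀₂ a₃₀ a₂₁ a₁₂ a₀₃) (0, 0) := by
  have hx : AnalyticAt ℝ (fun z : ℝ × ℝ => z.1) 0 := analyticAt_fst
  have hy : AnalyticAt ℝ (fun z : ℝ × ℝ => z.2) 0 := analyticAt_snd
  refine ⟨ContinuousLinearEquiv.refl ℝ _, -1,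
    fun z => z.1 * -(a₁₁ * z.2 + a₃₀ * z.1 ^ 2 + a₂₁ * z.1 * z.2 + a₁₂ * z.2 ^ 2)
      + z.2 * -(a₀₂ * z.2 + a₀₃ * z.2 ^ 2), fun z => z.1 * -z.1 ^ 2, by norm_num,
    .add (.mul_of_eq_zero hx (by fun_prop) rfl (by simp))
      (.mul_of_eq_zero hy (by fun_prop) rfl (by simp)),
    .mul_of_eq_zero hx (by fun_prop) rfl (by simp), Eventually.of_forall fun z => ?_⟩
  ext
  · simp [cubicField]; ring
  · simp [cubicField]; ring

theorem isCenter_cubicField {a₁₁ a₀₂ a₂₁ a₁₂ a₀₃ : ℝ} (h1 : a₀₂ * a₁₁ + a₁₂ = 0)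
    (h2 : a₀₂ * a₁₁ * a₂₁ = 0) (h3 : a₀₂ * a₁₁ * a₀₃ = 0) :
    IsCenter (cubicField a₁₁ a₀₂ 0 a₂₁ a₁₂ a₀₃) (0, 0) := by
  have key : cubicField a₁₁ a₀₂ 0 a₂₁ a₁₂ a₀₃ = fun z : ℝ × ℝ => (-(z.2 *
      (1 - a₁₁ * z.1 - a₀₂ * z.2 - a₂₁ * z.1 ^ 2 - a₁₂ * z.1 * z.2 - a₀₃ * z.2 ^ 2)),
      z.1 ^ 3) := by
    funext z
    simp only [cubicField, Prod.mk.injEq, and_true]; ring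
  rw [key]
  refine isCenter_of_symmetric (by fun_prop) (by simp) ?_
  by_cases h11 : a₁₁ = 0
  · have h12 : a₁₂ = 0 := by simpa [h11] using h1
    exact Or.inl fun x y => by simp [h11, h12]
  by_cases h02 : a₀₂ = 0
  · have h12 : a₁₂ = 0 := by simpa [h02] using h1
    exact Or.inr (Or.inl fun x y => by simp [h02, h12])
  have h21 : a₂₁ = 0 := by simpa [h11, h02] using h2
  have h03 : a₀₃ = 0 := by simpa [h11, h02] using h3
  refine Or.inr (Or.inr ⟨fun x => 1 - a₁₁ * x, fun y => 1 - a₀₂ * y, by fun_prop, by fun_prop,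
    by simp, by simp, fun z => ?_⟩)
  rw [h21, h03, ← neg_eq_of_add_eq_zero_right h1]; ring

/-! ### Lyapunov functions -/

/-- `D` is the derivative of `W` at `z` along the curves tangent to the vector field `v`. -/
def HasOrbitalDerivAt (v : ℝ × ℝ → ℝ × ℝ) (W : ℝ × ℝ → ℝ) (D : ℝ) (z : ℝ × ℝ) : Prop :=
  ∀ (γ : ℝ → ℝ × ℝ) (t : ℝ), HasDerivAt γ (v z) t → γ t = z →
    HasDerivAt (fun s => W (γ s)) D t

namespace HasOrbitalDerivAt

variable {v : ℝ × ℝ → ℝ × ℝ} {W₁ W₂ : ℝ × ℝ → ℝ} {D₁ D₂ : ℝ} {z : ℝ × ℝ}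

theorem congr (h : HasOrbitalDerivAt v W₁ D₁ z) (hW : ∀ z, W₂ z = W₁ z) (hD : D₂ = D₁) :
    HasOrbitalDerivAt v W₂ D₂ z := by
  rwa [show W₂ = W₁ from funext hW, hD]

theorem add (h₁ : HasOrbitalDerivAt v W₁ D₁ z) (h₂ : HasOrbitalDerivAt v W₂ D₂ z) :
    HasOrbitalDerivAt v (fun z => W₁ z + W₂ z) (D₁ + D₂) z := fun γ t hγ ht =>
  (h₁ γ t hγ ht).add (h₂ γ t hγ ht)

theorem mul (h₁ : HasOrbitalDerivAt v W₁ D₁ z) (h₂ : HasOrbitalDerivAt v W₂ D₂ z) :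
    HasOrbitalDerivAt v (fun z => W₁ z * W₂ z) (D₁ * W₂ z + W₁ z * D₂) z := fun γ t hγ ht => by
  simpa only [ht] using! (h₁ γ t hγ ht).mul (h₂ γ t hγ ht)

theorem const_mul (c : ℝ) (h₁ : HasOrbitalDerivAt v W₁ D₁ z) :
    HasOrbitalDerivAt v (fun z => c * W₁ z) (c * D₁) z := fun γ t hγ ht =>
  (h₁ γ t hγ ht).const_mul c

theorem fst (v : ℝ × ℝ → ℝ × ℝ) (z : ℝ × ℝ) : HasOrbitalDerivAt v (fun z => z.1) (v z).1 z :=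
  fun _ t hγ _ => (ContinuousLinearMap.fst ℝ ℝ ℝ).hasFDerivAt.comp_hasDerivAt t hγ

theorem snd (v : ℝ × ℝ → ℝ × ℝ) (z : ℝ × ℝ) : HasOrbitalDerivAt v (fun z => z.2) (v z).2 z :=
  fun _ t hγ _ => (ContinuousLinearMap.snd ℝ ℝ ℝ).hasFDerivAt.comp_hasDerivAt t hγ

theorem pow (h₁ : HasOrbitalDerivAt v W₁ D₁ z) (n : ℕ) :
    HasOrbitalDerivAt v (fun z => W₁ z ^ n) (n * W₁ z ^ (n - 1) * D₁) z := fun γ t hγ ht => by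
  simpa only [ht] using! (h₁ γ t hγ ht).pow n

theorem monomial (v : ℝ × ℝ → ℝ × ℝ) (z : ℝ × ℝ) (c : ℝ) (i j : ℕ) :
    HasOrbitalDerivAt v (fun z => c * (z.1 ^ i * z.2 ^ j))
      (c * (i * z.1 ^ (i - 1) * (v z).1 * z.2 ^ j + z.1 ^ i * (j * z.2 ^ (j - 1) * (v z).2))) z :=
  (((fst v z).pow i).mul ((snd v z).pow j)).const_mul c

theorem neg_field (h₁ : HasOrbitalDerivAt v W₁ D₁ z) : HasOrbitalDerivAt (-v) W₁ (-D₁) z := by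
  intro γ t hγ ht
  have h2 : HasDerivAt (fun s => γ (-s)) (v z) (-t) := by
    have := HasDerivAt.scomp (-t) (h := fun s : ℝ => -s) (g₁ := γ) (by rwa [neg_neg])
      (hasDerivAt_neg (-t))
    simpa using! this
  have h3 := (h₁ (fun s => γ (-s)) (-t) h2 (by simpa using ht)).scomp t (hasDerivAt_neg t)
  simpa [Function.comp_def] using h3

end HasOrbitalDerivAt

theorem IsCenter.neg {v : ℝ × ℝ → ℝ × ℝ} {p : ℝ × ℝ} (h : IsCenter v p) : IsCenter (-v) p := by
  obtain ⟨h0, U, hU, hper⟩ := h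
  refine ⟨by simp [h0], U, hU, fun q hq => ?_⟩
  obtain ⟨γ, hγ, hγ0, ⟨T, hT, hT'⟩, ⟨s, hs⟩, hmem⟩ := hper q hq
  refine ⟨fun t => γ (-t), fun t => ?_, by simpa using hγ0, ⟨T, hT, fun t => ?_⟩,
    ⟨-s, by simpa using hs⟩, fun t => hmem _⟩
  · have := HasDerivAt.scomp t (hγ (-t)) (hasDerivAt_neg t)
    simpa using! this
  · beta_reduce
    rw [neg_add, ← sub_eq_add_neg, hT'.sub_eq]

/-- A function `n`, periodic and initially smaller than `r`, stays smaller than `r` if some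
function that is nondecreasing as long as `n ≤ r` has larger values where `n = r`. -/
theorem lt_of_periodic_of_monotone {g n D : ℝ → ℝ} {r T : ℝ} (hT : 0 < T)
    (hper : Function.Periodic n T) (hn : Continuous n) (h0 : n 0 < r)
    (hg : ∀ t, n t ≤ r → HasDerivAt g (D t) t ∧ 0 ≤ D t) (hlt : ∀ t, n t = r → g 0 < g t)
    (t : ℝ) : n t < r := by
  by_contra! ht
  obtain ⟨k, hk⟩ := exists_nat_gt (t / T)
  rw [div_lt_iff₀ hT] at hk
  set S := {s | s ≤ 0 ∧ r ≤ n s}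
  have hne : S.Nonempty := ⟨t - k * T, by linarith, by rwa [hper.sub_nat_mul_eq]⟩
  have hbdd : BddAbove S := ⟨0, fun s hs => hs.1⟩
  have hcl : IsClosed S :=
    (isClosed_le continuous_id continuous_const).inter (isClosed_le continuous_const hn)
  obtain ⟨h1, h2⟩ := hcl.csSup_mem hne hbdd
  set s := sSup S
  have hin : ∀ τ, s < τ → τ ≤ 0 → n τ < r := fun τ h3 h4 => by
    by_contra! h5
    exact absurd (le_csSup hbdd ⟨h4, h5⟩) (not_le.2 h3)
  have hs : n s = r := by
    obtain ⟨τ, hτ, hτ'⟩ := intermediate_value_Icc' h1 hn.continuousOn ⟨h0.le, h2⟩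
    rcases hτ.1.eq_or_lt with h | h
    · rw [h, hτ']
    · exact absurd hτ' (hin τ h hτ.2).ne
  have hle : ∀ τ ∈ Set.Icc s 0, n τ ≤ r := fun τ hτ => by
    rcases hτ.1.eq_or_lt with h | h
    · rw [← h, hs]
    · exact (hin τ h hτ.2).le
  have hmono : MonotoneOn g (Set.Icc s 0) := by
    refine monotoneOn_of_deriv_nonneg (convex_Icc _ _)
      (fun τ hτ => (hg τ (hle τ hτ)).1.continuousAt.continuousWithinAt)
      (fun τ hτ => (hg τ (hle τ (interior_subset hτ))).1.differentiableAt.differentiableWithinAt)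
      fun τ hτ => ?_
    have := hg τ (hle τ (interior_subset hτ))
    rw [this.1.deriv]
    exact this.2
  exact absurd (hmono ⟨le_rfl, h1⟩ ⟨h1, le_rfl⟩ h1) (not_le.2 (hlt s hs))

/-- A Lyapunov function whose orbital derivative has constant sign and vanishes at most on the
`y`-axis excludes a center. -/
theorem not_isCenter_of_lyapunov {v : ℝ × ℝ → ℝ × ℝ} {H W D : ℝ × ℝ → ℝ}
    (hv : ∀ z : ℝ × ℝ, z.1 = 0 → (v z).2 = 0) (hH : Continuous H) (hHpos : ∀ z, z ≠ 0 → 0 < H z)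
    (hW0 : W 0 = 0) (hWc : ContinuousAt W 0) (hHW : ∀ᶠ z in 𝓝 (0 : ℝ × ℝ), H z ≤ W z)
    (hWD : ∀ᶠ z in 𝓝 (0 : ℝ × ℝ),
      z ≠ 0 → HasOrbitalDerivAt v W (D z) z ∧ 0 ≤ D z ∧ (D z = 0 → z.1 = 0)) :
    ¬ IsCenter v 0 := by
  rintro ⟨-, U, hU, hper⟩
  obtain ⟨ε, hε, hball⟩ := Metric.eventually_nhds_iff.1 (hHW.and hWD)
  have hr : 0 < ε / 2 := half_pos hε
  set r := ε / 2
  have hin : ∀ z : ℝ × ℝ, ‖z‖ ≤ r → H z ≤ W z ∧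
      (z ≠ 0 → HasOrbitalDerivAt v W (D z) z ∧ 0 ≤ D z ∧ (D z = 0 → z.1 = 0)) :=
    fun z hz => hball (by rw [dist_zero_right]; exact hz.trans_lt (half_lt_self hε))
  obtain ⟨w, hw, hmin⟩ := (isCompact_sphere (0 : ℝ × ℝ) r).exists_isMinOn
    (NormedSpace.sphere_nonempty.2 hr.le) hH.continuousOn
  have hw0 : w ≠ 0 := ne_zero_of_mem_sphere hr.ne' ⟨w, hw⟩
  have hnear : ∀ᶠ z in 𝓝 (0 : ℝ × ℝ), W z < H w ∧ ‖z‖ < r ∧ z ∈ U := by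
    refine (hWc.eventually_lt continuousAt_const (by rw [hW0]; exact hHpos w hw0)).and
      (Eventually.and ?_ hU)
    filter_upwards [Metric.ball_mem_nhds (0 : ℝ × ℝ) hr] with z hz using by simpa using hz
  obtain ⟨q, ⟨hqW, hqr, hqU⟩, hq0⟩ :=
    ((hnear.filter_mono nhdsWithin_le_nhds).and (self_mem_nhdsWithin (s := {0}ᶜ))).exists
  obtain ⟨γ, hγ, rfl, ⟨T, hT, hT'⟩, ⟨s, hs⟩, hmem⟩ := hper q ⟨hqU, hq0⟩
  have hne : ∀ t, γ t ≠ 0 := fun t => (hmem t).2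
  have hderiv : ∀ t, ‖γ t‖ ≤ r → HasDerivAt (fun t => W (γ t)) (D (γ t)) t ∧ 0 ≤ D (γ t) :=
    fun t ht => ⟨((hin _ ht).2 (hne t)).1 γ t (hγ t) rfl, ((hin _ ht).2 (hne t)).2.1⟩
  have htrap : ∀ t, ‖γ t‖ < r :=
    lt_of_periodic_of_monotone hT (fun t => by simp only [hT' t]) hγ.continuous.norm hqr hderiv
      fun t ht => hqW.trans_le ((hmin (by simpa using ht)).trans (hin _ ht.le).1)
  have hmono : Monotone fun t => W (γ t) :=
    monotone_of_deriv_nonneg (fun t => (hderiv t (htrap t).le).1.differentiableAt) fun t => by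
      rw [(hderiv t (htrap t).le).1.deriv]
      exact (hderiv t (htrap t).le).2
  have hconst : ∀ t, W (γ t) = W (γ 0) := by
    intro t
    obtain ⟨k, hk⟩ := exists_nat_gt (|t| / T)
    rw [div_lt_iff₀ hT, abs_lt] at hk
    have h1 := hmono hk.1.le
    have h2 := hmono hk.2.le
    have hkT := hT'.nat_mul_eq k
    have hkT' := hT'.sub_nat_mul_eq (x := 0) k
    rw [zero_sub] at hkT'
    simp only [hkT, hkT'] at h1 h2
    exact le_antisymm h2 h1
  have hx : ∀ t, (γ t).1 = 0 := by
    intro t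
    have h1 := (hderiv t (htrap t).le).1
    have h2 : HasDerivAt (fun t => W (γ t)) 0 t := by
      rw [show (fun t => W (γ t)) = fun _ => W (γ 0) from funext hconst]
      exact hasDerivAt_const _ _
    exact ((hin _ (htrap t).le).2 (hne t)).2.2 (h1.unique h2)
  have hy : ∀ t, HasDerivAt (fun t => (γ t).2) 0 t := fun t => by
    have := HasOrbitalDerivAt.snd v (γ t) γ t (hγ t) rfl
    rwa [hv _ (hx t)] at this
  have hyc := is_const_of_deriv_eq_zero (fun t => (hy t).differentiableAt)
    (fun t => (hy t).deriv) s 0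
  exact hs (Prod.ext ((hx s).trans (hx 0).symm) hyc)

/-! ### Weighted orders of vanishing -/

/-- The gauge for which `x` has weight one and `y` has weight two. -/
noncomputable def gauge (z : ℝ × ℝ) : ℝ := √√(z.1 ^ 4 + z.2 ^ 2)

theorem gauge_nonneg (z : ℝ × ℝ) : 0 ≤ gauge z := Real.sqrt_nonneg _

theorem gauge_sq (z : ℝ × ℝ) : gauge z ^ 2 = √(z.1 ^ 4 + z.2 ^ 2) :=
  Real.sq_sqrt (Real.sqrt_nonneg _)

theorem gauge_pow_four (z : ℝ × ℝ) : gauge z ^ 4 = z.1 ^ 4 + z.2 ^ 2 := by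
  rw [show 4 = 2 * 2 from rfl, pow_mul, gauge_sq, Real.sq_sqrt (by positivity)]

theorem continuous_gauge : Continuous gauge := by
  unfold gauge; fun_prop

theorem gauge_zero : gauge 0 = 0 := by simp [gauge]

theorem abs_fst_le_gauge (z : ℝ × ℝ) : |z.1| ≤ gauge z := by
  refine le_of_pow_le_pow_left₀ four_ne_zero (gauge_nonneg z) ?_
  rw [gauge_pow_four, Even.pow_abs (by decide)]
  linarith [sq_nonneg z.2]

theorem abs_snd_le_gauge_sq (z : ℝ × ℝ) : |z.2| ≤ gauge z ^ 2 := by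
  rw [gauge_sq]
  refine Real.abs_le_sqrt ?_
  linarith [Even.pow_nonneg (n := 4) (by decide) z.1]

/-- `f` vanishes at the origin to the weighted order `d`. -/
def HasWeight (d : ℕ) (f : ℝ × ℝ → ℝ) : Prop := f =O[𝓝 0] fun z => gauge z ^ d

namespace HasWeight

theorem mono {d e : ℕ} {f : ℝ × ℝ → ℝ} (h : HasWeight e f) (hde : d ≤ e) : HasWeight d f := by
  refine Asymptotics.IsBigO.trans h ?_
  obtain ⟨k, rfl⟩ := Nat.exists_eq_add_of_le hde
  have h1 : (fun z => gauge z ^ k) =O[𝓝 (0 : ℝ × ℝ)] fun _ => (1 : ℝ) :=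
    (continuous_gauge.pow k).continuousAt.isBigO_one ℝ
  simpa [pow_add] using (Asymptotics.isBigO_refl (fun z => gauge z ^ d) (𝓝 0)).mul h1

theorem add {d : ℕ} {f g : ℝ × ℝ → ℝ} (hf : HasWeight d f) (hg : HasWeight d g) :
    HasWeight d fun z => f z + g z := Asymptotics.IsBigO.add hf hg

theorem mul {d e : ℕ} {f g : ℝ × ℝ → ℝ} (hf : HasWeight d f) (hg : HasWeight e g) :
    HasWeight (d + e) fun z => f z * g z := by
  simpa only [HasWeight, pow_add] using Asymptotics.IsBigO.mul hf hg

theorem const_mul {d : ℕ} {f : ℝ × ℝ → ℝ} (c : ℝ) (hf : HasWeight d f) :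
    HasWeight d fun z => c * f z := Asymptotics.IsBigO.const_mul_left hf c

theorem monomial (c : ℝ) (i j : ℕ) {d : ℕ} (h : d ≤ i + 2 * j) :
    HasWeight d fun z => c * (z.1 ^ i * z.2 ^ j) := by
  have h1 : HasWeight 1 fun z => z.1 := Asymptotics.isBigO_of_le _ fun z => by
    rw [pow_one, Real.norm_eq_abs, Real.norm_of_nonneg (gauge_nonneg z)]
    exact abs_fst_le_gauge z
  have h2 : HasWeight 2 fun z => z.2 := Asymptotics.isBigO_of_le _ fun z => by
    rw [Real.norm_eq_abs, Real.norm_of_nonneg (pow_nonneg (gauge_nonneg z) 2)]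
    exact abs_snd_le_gauge_sq z
  have h3 : HasWeight (i + 2 * j) fun z => z.1 ^ i * z.2 ^ j := by
    have h4 := (Asymptotics.IsBigO.pow h1 i).mul (Asymptotics.IsBigO.pow h2 j)
    simpa only [HasWeight, ← pow_mul, one_mul, ← pow_add] using h4
  exact (h3.mono h).const_mul c

/-- A function of weight greater than `4k` is negligible compared with `(x⁴ + y²)ᵏ`. -/
theorem eventually_abs_le {k : ℕ} {f : ℝ × ℝ → ℝ} (hf : HasWeight (4 * k + 1) f) {ε : ℝ}
    (hε : 0 < ε) : ∀ᶠ z in 𝓝 (0 : ℝ × ℝ), |f z| ≤ ε * (z.1 ^ 4 + z.2 ^ 2) ^ k := by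
  have h1 : gauge =o[𝓝 0] fun _ => (1 : ℝ) := by
    rw [Asymptotics.isLittleO_one_iff]
    simpa [gauge_zero] using continuous_gauge.tendsto 0
  have h2 := (Asymptotics.isBigO_refl (fun z => gauge z ^ (4 * k)) (𝓝 0)).mul_isLittleO h1
  simp only [mul_one, ← pow_succ] at h2
  filter_upwards [(Asymptotics.IsBigO.trans_isLittleO hf h2).def hε] with z hz
  rwa [pow_mul, gauge_pow_four, Real.norm_eq_abs, Real.norm_of_nonneg (by positivity)] at hz

end HasWeight

theorem pow_four_add_sq_pos {z : ℝ × ℝ} (hz : z ≠ 0) : 0 < z.1 ^ 4 + z.2 ^ 2 := by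
  by_contra! h
  have h1 : 0 ≤ z.1 ^ 4 := by positivity
  have h2 : 0 ≤ z.2 ^ 2 := by positivity
  exact hz (Prod.ext (pow_eq_zero_iff four_ne_zero |>.1 (by linarith))
    (pow_eq_zero_iff two_ne_zero |>.1 (by linarith)))

theorem not_isCenter_of_pos {v : ℝ × ℝ → ℝ × ℝ} {W R S : ℝ × ℝ → ℝ} {k m : ℕ} {K : ℝ}
    (hK : 0 < K) (hv : ∀ z : ℝ × ℝ, z.1 = 0 → (v z).2 = 0) (hR : HasWeight 5 R)
    (hW : ∀ z, W z = z.1 ^ 4 / 4 + z.2 ^ 2 / 2 + R z) (hS : HasWeight (4 * k + 1) S)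
    (hD : ∀ z, z ≠ 0 → HasOrbitalDerivAt v W
      (z.1 ^ (2 * m) * (K * (z.1 ^ 4 + z.2 ^ 2) ^ k + S z)) z) :
    ¬ IsCenter v 0 := by
  have hR8 := HasWeight.eventually_abs_le (k := 1) hR (ε := 1 / 8) (by norm_num)
  have hR0 : R 0 = 0 := by
    have := hR8.self_of_nhds
    simpa using this
  have hRc : ContinuousAt R 0 := by
    rw [ContinuousAt, hR0]
    refine Asymptotics.IsBigO.trans_tendsto hR ?_
    simpa [gauge_zero] using! (continuous_gauge.pow 5).tendsto 0
  refine not_isCenter_of_lyapunov (H := fun z => (z.1 ^ 4 + z.2 ^ 2) / 8) (W := W)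
    (D := fun z => z.1 ^ (2 * m) * (K * (z.1 ^ 4 + z.2 ^ 2) ^ k + S z)) hv (by fun_prop)
    (fun z hz => div_pos (pow_four_add_sq_pos hz) (by norm_num)) (by simp [hW, hR0]) ?_ ?_ ?_
  · rw [show W = fun z => z.1 ^ 4 / 4 + z.2 ^ 2 / 2 + R z from funext hW]
    exact ContinuousAt.add (by fun_prop) hRc
  · filter_upwards [hR8] with z hz
    rw [hW]
    have := (abs_le.1 hz).1
    rw [pow_one] at this
    have h1 : 0 ≤ z.1 ^ 4 := by positivity
    have h2 : 0 ≤ z.2 ^ 2 := by positivity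
    linarith
  · filter_upwards [hS.eventually_abs_le (half_pos hK)] with z hz hz0
    have hx : 0 ≤ z.1 ^ (2 * m) := (even_two_mul m).pow_nonneg _
    have hpos : 0 < K * (z.1 ^ 4 + z.2 ^ 2) ^ k + S z := by
      have h1 := mul_pos (half_pos hK) (pow_pos (pow_four_add_sq_pos hz0) k)
      have h2 := (abs_le.1 hz).1
      linarith
    refine ⟨hD z hz0, mul_nonneg hx hpos.le, fun h => ?_⟩
    exact eq_zero_of_pow_eq_zero ((mul_eq_zero.1 h).resolve_right hpos.ne')

/-- If `W = x⁴/4 + y²/2 + R` has the orbital derivative `x²ᵐ (K (x⁴ + y²)ᵏ + S)` with `K ≠ 0` and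
`R`, `S` of higher weight, then the origin is not a center. -/
theorem not_isCenter_of_expansion {v : ℝ × ℝ → ℝ × ℝ} {R S : ℝ × ℝ → ℝ} (k m : ℕ) {K : ℝ}
    (hK : K ≠ 0) (hv : ∀ z, (v z).2 = z.1 ^ 3) (hR : HasWeight 5 R) (hS : HasWeight (4 * k + 1) S)
    (hD : ∀ z, z ≠ 0 → HasOrbitalDerivAt v R
      (z.1 ^ (2 * m) * (K * (z.1 ^ 4 + z.2 ^ 2) ^ k + S z) - z.1 ^ 3 * ((v z).1 + z.2)) z) :
    ¬ IsCenter v 0 := by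
  have hv0 : ∀ z : ℝ × ℝ, z.1 = 0 → (v z).2 = 0 := fun z hz => by simp [hv, hz]
  have hW : ∀ z, z ≠ 0 → HasOrbitalDerivAt v (fun z => z.1 ^ 4 / 4 + z.2 ^ 2 / 2 + R z)
      (z.1 ^ (2 * m) * (K * (z.1 ^ 4 + z.2 ^ 2) ^ k + S z)) z := fun z hz => by
    refine (((HasOrbitalDerivAt.monomial v z (1 / 4) 4 0).add
      (HasOrbitalDerivAt.monomial v z (1 / 2) 0 2)).add (hD z hz)).congr (fun z => ?_) ?_
    · ring
    · simp [hv]; ring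
  rcases hK.lt_or_gt with hK | hK
  · intro h
    refine not_isCenter_of_pos (k := k) (m := m) (neg_pos.2 hK) (fun z hz => by simp [hv0 z hz])
      hR (fun _ => rfl) (S := fun z => -1 * S z) (hS.const_mul (-1)) (fun z hz => ?_) h.neg
    exact (hW z hz).neg_field.congr (fun _ => rfl) (by ring)
  · exact not_isCenter_of_pos hK hv0 hR (fun _ => rfl) hS hW

/-- The argument of `x² + √2 y i`, divided by `√2`: a function whose derivative along
`ẋ = -y`, `ẏ = x³` is `x`. -/
noncomputable def angle (z : ℝ × ℝ) : ℝ := Complex.arg ⟨z.1 ^ 2, √2 * z.2⟩ / √2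

theorem hasWeight_angle : HasWeight 0 angle := by
  refine Asymptotics.IsBigO.of_bound (Real.pi / √2) (Eventually.of_forall fun z => ?_)
  rw [pow_zero, norm_one, mul_one, angle, norm_div, Real.norm_of_nonneg (Real.sqrt_nonneg 2)]
  exact div_le_div_of_nonneg_right (Complex.abs_arg_le_pi _) (Real.sqrt_nonneg 2)

theorem hasOrbitalDerivAt_angle (v : ℝ × ℝ → ℝ × ℝ) {z : ℝ × ℝ} (hz : z ≠ 0) :
    HasOrbitalDerivAt v angle
      ((z.1 ^ 2 * (v z).2 - 2 * z.1 * z.2 * (v z).1) / (z.1 ^ 4 + 2 * z.2 ^ 2)) z := by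
  intro γ t hγ ht
  have hx := ((HasOrbitalDerivAt.fst v z).pow 2 γ t hγ ht).ofReal_comp
  have hy := (((HasOrbitalDerivAt.snd v z).const_mul √2) γ t hγ ht).ofReal_comp
  have hf : HasDerivAt (fun s => (⟨(γ s).1 ^ 2, √2 * (γ s).2⟩ : ℂ))
      ⟨2 * z.1 * (v z).1, √2 * (v z).2⟩ t := by
    simpa [Complex.mk_eq_add_mul_I] using! hx.add (hy.mul_const Complex.I)
  have hslit : (⟨(γ t).1 ^ 2, √2 * (γ t).2⟩ : ℂ) ∈ Complex.slitPlane := by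
    rw [Complex.mem_slitPlane_iff, ht]
    by_cases h1 : z.1 = 0
    · right
      have h3 : z.2 ≠ 0 := fun h3 => hz (Prod.ext h1 h3)
      simp [h3]
    · left
      simpa using sq_pos_of_ne_zero h1
  have hlog := (Complex.imCLM.hasFDerivAt.comp_hasDerivAt t (hf.clog_real hslit)).div_const √2
  have hN : z.1 ^ 4 + 2 * z.2 ^ 2 ≠ 0 :=
    ne_of_gt (by linarith [pow_four_add_sq_pos hz, sq_nonneg z.2])
  have h2 : √2 ≠ 0 := by positivity
  have hsq : √2 ^ 2 = 2 := Real.sq_sqrt (by norm_num)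
  have hnorm : z.1 ^ 2 * z.1 ^ 2 + √2 * z.2 * (√2 * z.2) = z.1 ^ 4 + 2 * z.2 ^ 2 := by
    linear_combination z.2 ^ 2 * hsq
  convert! hlog using 1
  · funext s
    simp [angle, Complex.log_im]
  · rw [Complex.imCLM_apply, ht, Complex.div_im, Complex.normSq_mk]
    dsimp only
    rw [hnorm]
    field_simp

/-! ### Lyapunov quantities -/

/-- The first Lyapunov quantity is `a₃₀`. -/
theorem not_isCenter_of_a₃₀ {a₁₁ a₀₂ a₃₀ a₂₁ a₁₂ a₀₃ : ℝ} (h : a₃₀ ≠ 0) :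
    ¬ IsCenter (cubicField a₁₁ a₀₂ a₃₀ a₂₁ a₁₂ a₀₃) 0 := by
  have hR : HasWeight 5 fun z => (-1 / 4 * a₃₀) * (z.1 ^ 3 * z.2 ^ 1) + (1 / 5 * a₁₁) * (z.1 ^ 5 * z.2 ^ 0) := by
    repeat' apply HasWeight.add
    all_goals exact .monomial _ _ _ (by norm_num)
  have hS : HasWeight 5 fun z => (a₀₂ - 3 / 4 * a₁₁ * a₃₀) * (z.1 ^ 1 * z.2 ^ 2)
      + (a₂₁ - 3 / 4 * a₃₀ ^ 2 + a₁₁ ^ 2) * (z.1 ^ 3 * z.2 ^ 1)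
      + (a₁₁ * a₃₀) * (z.1 ^ 5 * z.2 ^ 0) + (-3 / 4 * a₀₂ * a₃₀) * (z.1 ^ 0 * z.2 ^ 3)
      + (a₁₂ - 3 / 4 * a₃₀ * a₂₁ + a₁₁ * a₀₂) * (z.1 ^ 2 * z.2 ^ 2)
      + (a₁₁ * a₂₁) * (z.1 ^ 4 * z.2 ^ 1) + (a₀₃ - 3 / 4 * a₃₀ * a₁₂) * (z.1 ^ 1 * z.2 ^ 3)
      + (a₁₁ * a₁₂) * (z.1 ^ 3 * z.2 ^ 2) + (-3 / 4 * a₃₀ * a₀₃) * (z.1 ^ 0 * z.2 ^ 4)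
      + (a₁₁ * a₀₃) * (z.1 ^ 2 * z.2 ^ 3) := by
    repeat' apply HasWeight.add
    all_goals exact .monomial _ _ _ (by norm_num)
  refine not_isCenter_of_expansion 1 1 (K := 3 / 4 * a₃₀) (by positivity) (fun _ => rfl) hR hS fun z _ => ?_
  refine HasOrbitalDerivAt.congr (by
    repeat' apply HasOrbitalDerivAt.add
    all_goals exact .monomial _ z _ _ _) (fun _ => rfl) ?_
  simp only [cubicField]
  push_cast
  ring

/-- If `a₃₀ = 0`, the second Lyapunov quantity is `c = a₀₂ a₁₁ + a₁₂`. -/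
theorem not_isCenter_of_a₁₂ {a₁₁ a₀₂ a₂₁ a₀₃ c : ℝ} (h : c ≠ 0) :
    ¬ IsCenter (cubicField a₁₁ a₀₂ 0 a₂₁ (c - a₀₂ * a₁₁) a₀₃) 0 := by
  have hR : HasWeight 5 fun z => (1 / 5 * a₁₁) * (z.1 ^ 5 * z.2 ^ 0) + (-1 / 3 * a₀₂) * (z.1 ^ 0 * z.2 ^ 3)
      + (1 / 6 * a₂₁ + 1 / 6 * a₁₁ ^ 2) * (z.1 ^ 6 * z.2 ^ 0)
      + (-1 / 10 * c) * (z.1 ^ 1 * z.2 ^ 3) + (1 / 10 * c) * (z.1 ^ 5 * z.2 ^ 1)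
      + (2 / 7 * a₁₁ * a₂₁ + 1 / 7 * a₁₁ ^ 3) * (z.1 ^ 7 * z.2 ^ 0) := by
    repeat' apply HasWeight.add
    all_goals exact .monomial _ _ _ (by norm_num)
  have hS : HasWeight 9 fun z => (-1 / 10 * a₁₁ * c) * (z.1 ^ 1 * z.2 ^ 4) + (a₀₃) * (z.1 ^ 3 * z.2 ^ 3)
      + (a₀₂ * a₂₁ + 3 / 2 * a₁₁ * c) * (z.1 ^ 5 * z.2 ^ 2)
      + (a₂₁ ^ 2 + 3 * a₁₁ ^ 2 * a₂₁ + a₁₁ ^ 4) * (z.1 ^ 7 * z.2 ^ 1)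
      + (-1 / 10 * a₀₂ * c) * (z.1 ^ 0 * z.2 ^ 5) + (-1 / 10 * a₂₁ * c) * (z.1 ^ 2 * z.2 ^ 4)
      + (1 / 2 * a₀₂ * c + a₁₁ * a₀₃) * (z.1 ^ 4 * z.2 ^ 3)
      + (3 / 2 * a₂₁ * c + a₁₁ * a₀₂ * a₂₁ + a₁₁ ^ 2 * c) * (z.1 ^ 6 * z.2 ^ 2)
      + (2 * a₁₁ * a₂₁ ^ 2 + a₁₁ ^ 3 * a₂₁) * (z.1 ^ 8 * z.2 ^ 1)
      + (-1 / 10 * c ^ 2 + 1 / 10 * a₁₁ * a₀₂ * c) * (z.1 ^ 1 * z.2 ^ 5)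
      + (1 / 2 * c ^ 2 + a₂₁ * a₀₃ - 1 / 2 * a₁₁ * a₀₂ * c + a₁₁ ^ 2 * a₀₃) * (z.1 ^ 5 * z.2 ^ 3)
      + (2 * a₁₁ * a₂₁ * c - 2 * a₁₁ ^ 2 * a₀₂ * a₂₁ + a₁₁ ^ 3 * c - a₁₁ ^ 4 * a₀₂) * (z.1 ^ 7 * z.2 ^ 2)
      + (-1 / 10 * c * a₀₃) * (z.1 ^ 0 * z.2 ^ 6) + (1 / 2 * c * a₀₃) * (z.1 ^ 4 * z.2 ^ 4)
      + (2 * a₁₁ * a₂₁ * a₀₃ + a₁₁ ^ 3 * a₀₃) * (z.1 ^ 6 * z.2 ^ 3) := by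
    repeat' apply HasWeight.add
    all_goals exact .monomial _ _ _ (by norm_num)
  refine not_isCenter_of_expansion 2 0 (K := 1 / 10 * c) (by positivity) (fun _ => rfl) hR hS fun z _ => ?_
  refine HasOrbitalDerivAt.congr (by
    repeat' apply HasOrbitalDerivAt.add
    all_goals exact .monomial _ z _ _ _) (fun _ => rfl) ?_
  simp only [cubicField]
  push_cast
  ring

/-- If `a₃₀ = a₀₂ a₁₁ + a₁₂ = a₂₁ = 0`, the last Lyapunov quantity is `a₀₂ a₁₁ a₀₃`. -/
theorem not_isCenter_of_a₀₃ {a₁₁ a₀₂ a₀₃ : ℝ} (h : a₀₂ * a₁₁ * a₀₃ ≠ 0) :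
    ¬ IsCenter (cubicField a₁₁ a₀₂ 0 0 (-(a₀₂ * a₁₁)) a₀₃) 0 := by
  have hR : HasWeight 5 fun z => (1 / 5 * a₁₁) * (z.1 ^ 5 * z.2 ^ 0) + (-1 / 3 * a₀₂) * (z.1 ^ 0 * z.2 ^ 3)
      + (1 / 6 * a₁₁ ^ 2) * (z.1 ^ 6 * z.2 ^ 0) + (1 / 7 * a₁₁ ^ 3) * (z.1 ^ 7 * z.2 ^ 0)
      + (-1 / 4 * a₀₃) * (z.1 ^ 0 * z.2 ^ 4) + (1 / 8 * a₁₁ ^ 4) * (z.1 ^ 8 * z.2 ^ 0)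
      + (1 / 5 * a₁₁ * a₀₃) * (z.1 ^ 5 * z.2 ^ 2)
      + (2 / 45 * a₁₁ * a₀₃ + 1 / 9 * a₁₁ ^ 5) * (z.1 ^ 9 * z.2 ^ 0)
      + (1 / 3 * a₁₁ ^ 2 * a₀₃) * (z.1 ^ 6 * z.2 ^ 2)
      + (8 / 75 * a₁₁ ^ 2 * a₀₃ + 1 / 10 * a₁₁ ^ 6) * (z.1 ^ 10 * z.2 ^ 0)
      + (-5 / 84 * a₁₁ * a₀₂ * a₀₃) * (z.1 ^ 1 * z.2 ^ 5)
      + (11 / 105 * a₁₁ * a₀₂ * a₀₃) * (z.1 ^ 5 * z.2 ^ 3)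
      + (3 / 7 * a₁₁ ^ 3 * a₀₃) * (z.1 ^ 7 * z.2 ^ 2)
      + (5 / 84 * a₁₁ * a₀₂ * a₀₃) * (z.1 ^ 9 * z.2 ^ 1)
      + (202 / 1155 * a₁₁ ^ 3 * a₀₃ + 1 / 11 * a₁₁ ^ 7) * (z.1 ^ 11 * z.2 ^ 0) := by
    repeat' apply HasWeight.add
    all_goals exact .monomial _ _ _ (by norm_num)
  have hS : HasWeight 13 fun z => (-5 / 84 * a₁₁ ^ 2 * a₀₂ * a₀₃) * (z.1 ^ 1 * z.2 ^ 6)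
      + (32 / 21 * a₁₁ ^ 2 * a₀₂ * a₀₃) * (z.1 ^ 5 * z.2 ^ 4)
      + (4 * a₁₁ ^ 4 * a₀₃) * (z.1 ^ 7 * z.2 ^ 3)
      + (101 / 84 * a₁₁ ^ 2 * a₀₂ * a₀₃) * (z.1 ^ 9 * z.2 ^ 2)
      + (202 / 105 * a₁₁ ^ 4 * a₀₃ + a₁₁ ^ 8) * (z.1 ^ 11 * z.2 ^ 1)
      + (-5 / 84 * a₁₁ * a₀₂ ^ 2 * a₀₃) * (z.1 ^ 0 * z.2 ^ 7)
      + (a₁₁ * a₀₃ ^ 2 + 11 / 21 * a₁₁ * a₀₂ ^ 2 * a₀₃) * (z.1 ^ 4 * z.2 ^ 5)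
      + (a₁₁ ^ 3 * a₀₂ * a₀₃) * (z.1 ^ 6 * z.2 ^ 4)
      + (2 / 5 * a₁₁ * a₀₃ ^ 2 + 15 / 28 * a₁₁ * a₀₂ ^ 2 * a₀₃ + a₁₁ ^ 5 * a₀₃) * (z.1 ^ 8 * z.2 ^ 3)
      + (6 / 7 * a₁₁ ^ 3 * a₀₂ * a₀₃) * (z.1 ^ 10 * z.2 ^ 2)
      + (5 / 84 * a₁₁ ^ 2 * a₀₂ ^ 2 * a₀₃) * (z.1 ^ 1 * z.2 ^ 7)
      + (2 * a₁₁ ^ 2 * a₀₃ ^ 2 - 11 / 21 * a₁₁ ^ 2 * a₀₂ ^ 2 * a₀₃) * (z.1 ^ 5 * z.2 ^ 5)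
      + (-3 * a₁₁ ^ 4 * a₀₂ * a₀₃) * (z.1 ^ 7 * z.2 ^ 4)
      + (16 / 15 * a₁₁ ^ 2 * a₀₃ ^ 2 - 15 / 28 * a₁₁ ^ 2 * a₀₂ ^ 2 * a₀₃ + a₁₁ ^ 6 * a₀₃) * (z.1 ^ 9 * z.2 ^ 3)
      + (-202 / 105 * a₁₁ ^ 4 * a₀₂ * a₀₃ - a₁₁ ^ 8 * a₀₂) * (z.1 ^ 11 * z.2 ^ 2)
      + (-5 / 84 * a₁₁ * a₀₂ * a₀₃ ^ 2) * (z.1 ^ 0 * z.2 ^ 8)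
      + (11 / 21 * a₁₁ * a₀₂ * a₀₃ ^ 2) * (z.1 ^ 4 * z.2 ^ 6)
      + (3 * a₁₁ ^ 3 * a₀₃ ^ 2) * (z.1 ^ 6 * z.2 ^ 5)
      + (15 / 28 * a₁₁ * a₀₂ * a₀₃ ^ 2) * (z.1 ^ 8 * z.2 ^ 4)
      + (202 / 105 * a₁₁ ^ 3 * a₀₃ ^ 2 + a₁₁ ^ 7 * a₀₃) * (z.1 ^ 10 * z.2 ^ 3) := by
    repeat' apply HasWeight.add
    all_goals exact .monomial _ _ _ (by norm_num)
  refine not_isCenter_of_expansion 3 0 (K := 5 / 84 * (a₀₂ * a₁₁ * a₀₃)) (by positivity) (fun _ => rfl) hR hS fun z _ => ?_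
  refine HasOrbitalDerivAt.congr (by
    repeat' apply HasOrbitalDerivAt.add
    all_goals exact .monomial _ z _ _ _) (fun _ => rfl) ?_
  simp only [cubicField]
  push_cast
  ring

/-- If `a₃₀ = a₀₂ a₁₁ + a₁₂ = 0`, the third Lyapunov quantity is `a₀₂ a₁₁ a₂₁`. -/
theorem not_isCenter_of_a₂₁ {a₁₁ a₀₂ a₂₁ a₀₃ : ℝ} (h : a₀₂ * a₁₁ * a₂₁ ≠ 0) :
    ¬ IsCenter (cubicField a₁₁ a₀₂ 0 a₂₁ (-(a₀₂ * a₁₁)) a₀₃) 0 := by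
  have hR : HasWeight 5 fun z => (1 / 5 * a₁₁) * (z.1 ^ 5 * z.2 ^ 0) + (-1 / 3 * a₀₂) * (z.1 ^ 0 * z.2 ^ 3)
      + (1 / 6 * a₂₁ + 1 / 6 * a₁₁ ^ 2) * (z.1 ^ 6 * z.2 ^ 0)
      + (2 / 7 * a₁₁ * a₂₁ + 1 / 7 * a₁₁ ^ 3) * (z.1 ^ 7 * z.2 ^ 0)
      + (-1 / 4 * a₀₃) * (z.1 ^ 0 * z.2 ^ 4) + (-1 / 8 * a₀₂ * a₂₁) * (z.1 ^ 2 * z.2 ^ 3)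
      + (1 / 16 * a₀₂ * a₂₁) * (z.1 ^ 6 * z.2 ^ 1)
      + (1 / 8 * a₂₁ ^ 2 + 3 / 8 * a₁₁ ^ 2 * a₂₁ + 1 / 8 * a₁₁ ^ 4) * (z.1 ^ 8 * z.2 ^ 0)
      + (-1 / 50 * a₁₁ * a₀₂ * a₂₁) * (z.1 ^ 3 * z.2 ^ 3)
      + (1 / 5 * a₁₁ * a₀₃) * (z.1 ^ 5 * z.2 ^ 2)
      + (4 / 25 * a₁₁ * a₀₂ * a₂₁) * (z.1 ^ 7 * z.2 ^ 1)
      + (2 / 45 * a₁₁ * a₀₃ + 1 / 3 * a₁₁ * a₂₁ ^ 2 + 4 / 9 * a₁₁ ^ 3 * a₂₁ + 1 / 9 * a₁₁ ^ 5) * (z.1 ^ 9 * z.2 ^ 0) := by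
    repeat' apply HasWeight.add
    all_goals exact .monomial _ _ _ (by norm_num)
  have hQ : HasWeight 8 fun z => (-1 / 4 * a₀₂ * a₂₁) * (z.1 ^ 0 * z.2 ^ 4) + (-1 / 4 * a₀₂ * a₂₁) * (z.1 ^ 4 * z.2 ^ 2)
      + (-1 / 16 * a₀₂ * a₂₁) * (z.1 ^ 8 * z.2 ^ 0)
      + (-1 / 5 * a₁₁ * a₀₂ * a₂₁) * (z.1 ^ 5 * z.2 ^ 2)
      + (-1 / 10 * a₁₁ * a₀₂ * a₂₁) * (z.1 ^ 9 * z.2 ^ 0) := by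
    repeat' apply HasWeight.add
    all_goals exact .monomial _ _ _ (by norm_num)
  have hS : HasWeight 9 fun z => (-3 / 50 * a₁₁ ^ 2 * a₀₂ * a₂₁) * (z.1 ^ 1 * z.2 ^ 4)
      + (a₂₁ * a₀₃ + 1 / 2 * a₀₂ ^ 2 * a₂₁ + 2 * a₁₁ ^ 2 * a₀₃) * (z.1 ^ 3 * z.2 ^ 3)
      + (3 / 2 * a₀₂ * a₂₁ ^ 2 + 58 / 25 * a₁₁ ^ 2 * a₀₂ * a₂₁) * (z.1 ^ 5 * z.2 ^ 2)
      + (a₂₁ ^ 3 + 2 / 5 * a₁₁ ^ 2 * a₀₃ + 6 * a₁₁ ^ 2 * a₂₁ ^ 2 + 5 * a₁₁ ^ 4 * a₂₁ + a₁₁ ^ 6) * (z.1 ^ 7 * z.2 ^ 1)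
      + (-3 / 50 * a₁₁ * a₀₂ ^ 2 * a₂₁) * (z.1 ^ 0 * z.2 ^ 5)
      + (a₁₁ * a₀₂ * a₀₃ - 3 / 50 * a₁₁ * a₀₂ * a₂₁ ^ 2) * (z.1 ^ 2 * z.2 ^ 4)
      + (3 * a₁₁ * a₂₁ * a₀₃ + 41 / 50 * a₁₁ * a₀₂ ^ 2 * a₂₁ + a₁₁ ^ 3 * a₀₃) * (z.1 ^ 4 * z.2 ^ 3)
      + (2 / 5 * a₁₁ * a₀₂ * a₀₃ + 83 / 25 * a₁₁ * a₀₂ * a₂₁ ^ 2 + a₁₁ ^ 3 * a₀₂ * a₂₁) * (z.1 ^ 6 * z.2 ^ 2)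
      + (2 / 5 * a₁₁ * a₂₁ * a₀₃ + 3 * a₁₁ * a₂₁ ^ 3 + 4 * a₁₁ ^ 3 * a₂₁ ^ 2 + a₁₁ ^ 5 * a₂₁) * (z.1 ^ 8 * z.2 ^ 1)
      + (3 / 50 * a₁₁ ^ 2 * a₀₂ ^ 2 * a₂₁) * (z.1 ^ 1 * z.2 ^ 5)
      + (1 / 2 * a₀₂ * a₂₁ * a₀₃ - a₁₁ ^ 2 * a₀₂ * a₀₃) * (z.1 ^ 3 * z.2 ^ 4)
      + (a₂₁ ^ 2 * a₀₃ + 3 * a₁₁ ^ 2 * a₂₁ * a₀₃ - 33 / 25 * a₁₁ ^ 2 * a₀₂ ^ 2 * a₂₁ + a₁₁ ^ 4 * a₀₃) * (z.1 ^ 5 * z.2 ^ 3)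
      + (-2 / 5 * a₁₁ ^ 2 * a₀₂ * a₀₃ - 3 * a₁₁ ^ 2 * a₀₂ * a₂₁ ^ 2 - 4 * a₁₁ ^ 4 * a₀₂ * a₂₁ - a₁₁ ^ 6 * a₀₂) * (z.1 ^ 7 * z.2 ^ 2)
      + (-3 / 50 * a₁₁ * a₀₂ * a₂₁ * a₀₃) * (z.1 ^ 0 * z.2 ^ 6)
      + (a₁₁ * a₀₃ ^ 2) * (z.1 ^ 2 * z.2 ^ 5)
      + (33 / 25 * a₁₁ * a₀₂ * a₂₁ * a₀₃) * (z.1 ^ 4 * z.2 ^ 4)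
      + (2 / 5 * a₁₁ * a₀₃ ^ 2 + 3 * a₁₁ * a₂₁ ^ 2 * a₀₃ + 4 * a₁₁ ^ 3 * a₂₁ * a₀₃ + a₁₁ ^ 5 * a₀₃) * (z.1 ^ 6 * z.2 ^ 3) := by
    repeat' apply HasWeight.add
    all_goals exact .monomial _ _ _ (by norm_num)
  have hT : HasWeight 9 fun z => (-a₀₂ ^ 2 * a₂₁) * (z.1 ^ 1 * z.2 ^ 4)
      + (-a₀₂ * a₂₁ ^ 2 - a₁₁ ^ 2 * a₀₂ * a₂₁) * (z.1 ^ 3 * z.2 ^ 3)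
      + (-1 / 2 * a₀₂ ^ 2 * a₂₁) * (z.1 ^ 5 * z.2 ^ 2)
      + (-1 / 2 * a₀₂ * a₂₁ ^ 2 - 9 / 10 * a₁₁ ^ 2 * a₀₂ * a₂₁) * (z.1 ^ 7 * z.2 ^ 1)
      + (-a₁₁ * a₀₂ * a₂₁ ^ 2) * (z.1 ^ 4 * z.2 ^ 3)
      + (-2 / 5 * a₁₁ * a₀₂ ^ 2 * a₂₁) * (z.1 ^ 6 * z.2 ^ 2)
      + (-9 / 10 * a₁₁ * a₀₂ * a₂₁ ^ 2) * (z.1 ^ 8 * z.2 ^ 1)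
      + (-a₀₂ * a₂₁ * a₀₃) * (z.1 ^ 1 * z.2 ^ 5) + (a₁₁ ^ 2 * a₀₂ ^ 2 * a₂₁) * (z.1 ^ 3 * z.2 ^ 4)
      + (-1 / 2 * a₀₂ * a₂₁ * a₀₃) * (z.1 ^ 5 * z.2 ^ 3)
      + (9 / 10 * a₁₁ ^ 2 * a₀₂ ^ 2 * a₂₁) * (z.1 ^ 7 * z.2 ^ 2)
      + (-a₁₁ * a₀₂ * a₂₁ * a₀₃) * (z.1 ^ 2 * z.2 ^ 5)
      + (-9 / 10 * a₁₁ * a₀₂ * a₂₁ * a₀₃) * (z.1 ^ 6 * z.2 ^ 3) := by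
    repeat' apply HasWeight.add
    all_goals exact .monomial _ _ _ (by norm_num)
  refine not_isCenter_of_expansion 2 1 (K := 3 / 50 * (a₀₂ * a₁₁ * a₂₁)) (by positivity)
    (fun _ => rfl) (hR.add ((hQ.mul hasWeight_angle).mono (by norm_num)))
    (hS.add (hT.mul hasWeight_angle)) fun z hz => ?_
  have hN : z.1 ^ 4 + 2 * z.2 ^ 2 ≠ 0 :=
    ne_of_gt (by linarith [pow_four_add_sq_pos hz, sq_nonneg z.2])
  refine HasOrbitalDerivAt.congr (HasOrbitalDerivAt.add (by
      repeat' apply HasOrbitalDerivAt.add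
      all_goals exact .monomial _ z _ _ _) (HasOrbitalDerivAt.mul (by
      repeat' apply HasOrbitalDerivAt.add
      all_goals exact .monomial _ z _ _ _) (hasOrbitalDerivAt_angle _ hz))) (fun _ => rfl) ?_
  have key : ∀ A : ℝ, ((-1 / 4 * a₀₂ * a₂₁) * (z.1 ^ 0 * z.2 ^ 4) + (-1 / 4 * a₀₂ * a₂₁) * (z.1 ^ 4 * z.2 ^ 2)
      + (-1 / 16 * a₀₂ * a₂₁) * (z.1 ^ 8 * z.2 ^ 0)
      + (-1 / 5 * a₁₁ * a₀₂ * a₂₁) * (z.1 ^ 5 * z.2 ^ 2)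
      + (-1 / 10 * a₁₁ * a₀₂ * a₂₁) * (z.1 ^ 9 * z.2 ^ 0)) *
      (A / (z.1 ^ 4 + 2 * z.2 ^ 2)) =
      -(a₀₂ * a₂₁) / 4 * (z.1 ^ 4 / 4 + z.2 ^ 2 / 2 + 2 / 5 * a₁₁ * z.1 ^ 5) * A := fun A => by
    rw [← mul_div_assoc, div_eq_iff hN]
    ring
  rw [key]
  simp only [cubicField]
  push_cast
  ring

end PlanarSystem

theorem mainTheorem8 (a₁₁ a₀₂ a₃₀ a₂₁ a₁₂ a₀₃ : ℝ) :
    PlanarSystem.IsNilpotentCenter (PlanarSystem.cubicField a₁₁ a₀₂ a₃₀ a₂₁ a₁₂ a₀₃) (0, 0) ↔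
      a₃₀ = 0 ∧ a₀₂ * a₁₁ + a₁₂ = 0 ∧ a₀₂ * a₁₁ * a₂₁ = 0 ∧ a₀₂ * a₁₁ * a₀₃ = 0 := by
  constructor
  · rintro ⟨h, -⟩
    have h30 : a₃₀ = 0 := by
      by_contra h0
      exact PlanarSystem.not_isCenter_of_a₃₀ h0 h
    subst h30
    have h12 : a₀₂ * a₁₁ + a₁₂ = 0 := by
      by_contra h0
      refine PlanarSystem.not_isCenter_of_a₁₂ (a₁₁ := a₁₁) (a₀₂ := a₀₂) (a₂₁ := a₂₁) (a₀₃ := a₀₃)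
        h0 ?_
      rwa [add_sub_cancel_left]
    obtain rfl := eq_neg_of_add_eq_zero_right h12
    have h21 : a₀₂ * a₁₁ * a₂₁ = 0 := by
      by_contra h0
      exact PlanarSystem.not_isCenter_of_a₂₁ h0 h
    refine ⟨rfl, h12, h21, ?_⟩
    by_contra h0
    obtain rfl : a₂₁ = 0 := (mul_eq_zero.1 h21).resolve_left (left_ne_zero_of_mul h0)
    exact PlanarSystem.not_isCenter_of_a₀₃ h0 h
  · rintro ⟨rfl, h1, h2, h3⟩
    exact ⟨PlanarSystem.isCenter_cubicField h1 h2 h3,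
      PlanarSystem.hasNilpotentForm_cubicField _ _ _ _ _ _⟩
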